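/- Let $\mathbb{K}$ be a field of characteristic zero, let $\gamma \geq 0$ be an integer and $[\gamma] := \{1, \dots, \gamma\}$. **Polydendriform algebras.** Let $\mathsf{Dias}_\gamma$ be the nonsymmetric operad of words on $\{0\} \cup [\gamma]$ generated by the words $0a$ and $a0$, $a \in [\gamma]$, for the partial compositions $u \circ_i v := u_1 \cdots u_{i-1}\, \max(u_i, v_1) \cdots \max(u_i, v_m)\, u_{i+1} \cdots u_n$ (extended linearly, with unit the word $0$). Let $G$ be the set of binary generators $\leftharpoonup_a, \rightharpoonup_a$, $a \in [\gamma]$, let $R$ be the kernel in arity $3$ of the operad morphism from the free operad $\mathbf{Free}(G)$ to $\mathsf{Dias}_\gamma$ sending $\leftharpoonup_a$ to $0a$ and $\rightharpoonup_a$ to $a0$, and let $R^\perp \subseteq \mathbf{Free}(G)(3)$ be its annihilator for the bilinear form for which the trees $x \circ_i y$ ($x, y \in G$, $i \in \{1, 2\}$) are pairwise orthogonal, with $\langle x \circ_1 y, x \circ_1 y\rangle = 1$ and $\langle x \circ_2 y, x \circ_2 y\rangle = -1$. The operad $\mathsf{Dendr}_\gamma := \mathbf{Free}(G)/\langle R^\perp\rangle$,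 where $\langle R^\perp \rangle$ is the operad ideal generated by $R^\perp$, is the Koszul dual of $\mathsf{Dias}_\gamma$. A *$\gamma$-polydendriform algebra* is a $\mathsf{Dendr}_\gamma$-algebra, that is, a $\mathbb{K}$-vector space with bilinear operations $\leftharpoonup_a, \rightharpoonup_a$, $a \in [\gamma]$, satisfying $r(e_1, e_2, e_3) = 0$ for all $r \in R^\perp$ and all elements $e_1, e_2, e_3$; morphisms are the linear maps commuting with these operations. In such an algebra set $\prec_b := \sum_{a = 1}^{b} \leftharpoonup_a$ and $\succ_b := \sum_{a = 1}^{b} \rightharpoonup_a$ for $b \in [\gamma]$ (by triangularity these determine the $\leftharpoonup_a$ and $\rightharpoonup_a$). **Edge valued binary trees.** A *$\gamma$-edge valued binary tree* is a planar binary tree with at least one internal node, each of whose edges joining two internal nodes is labeled by an element of $[\gamma]$; edges ending at a leaf are considered to be labeled by $\infty$. Write $(\mathfrak{t}_1, x, y, \mathfrak{t}_2)$ for the tree whose root has left (resp. right) subtree $\mathfrak{t}_1$ (resp. $\mathfrak{t}_2$), possibly a leaf, hanging from an edge labeled $x$ (resp. $y$). Let $\mathcal{F}$ be the vector space spanned by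 the $\gamma$-edge valued binary trees, $\mathcal{F}(n)$ the subspace spanned by those with exactly $n$ internal nodes, and $\bullet$ the tree with exactly one internal node. Define bilinear operations $\prec_a, \succ_a$, $a \in [\gamma]$, on $\mathcal{F}$ recursively, for every tree $\mathfrak{s}$ and all trees or leaves $\mathfrak{t}_1, \mathfrak{t}_2$, by $$(\mathfrak{t}_1, x, y, \mathfrak{t}_2) \prec_a \mathfrak{s} := (\mathfrak{t}_1, x, \min(a, y), \mathfrak{t}_2 \prec_a \mathfrak{s}) + (\mathfrak{t}_1, x, \min(a, y), \mathfrak{t}_2 \succ_y \mathfrak{s}),$$ $$\mathfrak{s} \succ_a (\mathfrak{t}_1, x, y, \mathfrak{t}_2) := (\mathfrak{s} \succ_a \mathfrak{t}_1, \min(a, x), y, \mathfrak{t}_2) + (\mathfrak{s} \prec_x \mathfrak{t}_1, \min(a, x), y, \mathfrak{t}_2),$$ where, for $\mathfrak{l}$ a leaf and $c \in [\gamma] \cup \{\infty\}$, $\mathfrak{s} \prec_c \mathfrak{l} := \mathfrak{s} =: \mathfrak{l} \succ_c \mathfrak{s}$ and $\mathfrak{l} \prec_c \mathfrak{s} :=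 0 =: \mathfrak{s} \succ_c \mathfrak{l}$, and where $(\cdot, x, y, \cdot)$ is extended linearly in its subtrees. **Theorem.** The space $\mathcal{F}$ endowed with the operations $\prec_a, \succ_a$, $a \in [\gamma]$, is the free $\gamma$-polydendriform algebra over one generator, the generator being $\bullet$. That is: 1. there is a $\gamma$-polydendriform algebra structure on $\mathcal{F}$ whose operations $\prec_a$, $\succ_a$ are those defined recursively above; 2. for every $\gamma$-polydendriform algebra $B$ and every $b \in B$ there is a unique morphism of $\gamma$-polydendriform algebras $\varphi : \mathcal{F} \to B$ with $\varphi(\bullet) = b$; 3. the map $\mathbf{Free}(G) \to \mathcal{F}$, $x \mapsto x(\bullet, \dots, \bullet)$, has kernel exactly $\langle R^\perp \rangle$ and maps $\mathbf{Free}(G)(n)$ onto $\mathcal{F}(n)$ for all $n$; hence it induces an isomorphism from the free algebra $\bigoplus_{n \geq 1} \mathsf{Dendr}_\gamma(n)$ onto $\mathcal{F}$, with $\mathsf{Dendr}_\gamma(n) \cong \mathcal{F}(n)$. -/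

import Mathlib

namespace Polydendriform

noncomputable section

open Finsupp

/-! ### Syntax trees on binary generators and the free operad

Leaves of a tree and letters of a word are numbered from `0`, so that the partial composition
usually written `∘ᵢ` with `i = 1, …, n` is here the one at position `i - 1`. -/

/-- Syntax trees all of whose internal nodes are binary and labeled by elements of `G`. -/
inductive SynTree (G : Type) : Type
  | leaf : SynTree G
  | node (g : G) (l r : SynTree G) : SynTree G

namespace SynTree

variable {G : Type}

/-- The number of leaves. -/
def arity : SynTree G → ℕ
  | leaf => 1
  | node _ l r => arity l + arity r

/-- `graft t i s` grafts the root of `s` on the leaf of `t` at position `i` (for `i < arity t`):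
the partial composition of the free operad. -/
def graft : SynTree G → ℕ → SynTree G → SynTree G
  | leaf, i, s => if i = 0 then s else leaf
  | node g l r, i, s =>
      if i < arity l then node g (graft l i s) r else node g l (graft r (i - arity l) s)

/-- The operation defined by a syntax tree: the leaf at position `i` receives the input `e i`
and every node `g` acts by the binary operation `op g`. -/
def evalAt {A : Type*} (op : G → A → A → A) : SynTree G → (ℕ → A) → A
  | leaf, e => e 0
  | node g l r, e => op g (evalAt op l e) (evalAt op r (fun i => e (i + arity l)))

end SynTree

/-- The total space `⨁ₙ Free(G)(n)` of the free operad on the binary generators `G`. -/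
abbrev FreeOperad (K : Type*) [Field K] (G : Type) : Type _ := SynTree G →₀ K

/-- The homogeneous component `Free(G)(n)` of arity `n`. -/
def freeComponent (K : Type*) [Field K] (G : Type) (n : ℕ) : Submodule K (FreeOperad K G) :=
  Finsupp.supported K K {t : SynTree G | t.arity = n}

/-- Operad ideals of the free operad: graded subspaces stable under partial compositions, on
either side, with arbitrary elements (equivalently, with arbitrary trees). -/
structure IsOperadIdeal {K : Type*} [Field K] {G : Type}
    (I : Submodule K (FreeOperad K G)) : Prop where
  graded : ∀ x ∈ I, ∀ n : ℕ, x.filter (fun t => t.arity = n) ∈ I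
  comp_tree : ∀ n : ℕ, ∀ x ∈ I, x ∈ freeComponent K G n → ∀ i < n, ∀ s : SynTree G,
    Finsupp.mapDomain (fun t : SynTree G => t.graft i s) x ∈ I
  tree_comp : ∀ x ∈ I, ∀ s : SynTree G, ∀ i < s.arity,
    Finsupp.mapDomain (fun t : SynTree G => s.graft i t) x ∈ I

/-- The operad ideal `⟨R⟩` generated by `R`. -/
def operadIdeal {K : Type*} [Field K] {G : Type} (R : Submodule K (FreeOperad K G)) :
    Submodule K (FreeOperad K G) :=
  sInf {I | IsOperadIdeal I ∧ R ≤ I}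

/-- The element of `A` obtained by applying the operation `x` of the free operad to the inputs
`e 0, e 1, …`, when every generator `g` acts by the bilinear operation `op g`. -/
def act {K : Type*} [Field K] {G : Type} {A : Type*} [AddCommGroup A] [Module K A]
    (op : G → A →ₗ[K] A →ₗ[K] A) (e : ℕ → A) : FreeOperad K G →ₗ[K] A :=
  Finsupp.linearCombination K (fun t : SynTree G => t.evalAt (fun g x y => op g x y) e)

/-! ### The pluriassociative operad

The set `[γ] = {1, …, γ}` is modelled by `Fin γ` and the monoid `({0, 1, …, γ}, max)` by
`WithBot (Fin γ)` with `⊔`, the integer `0` being `⊥`. -/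

/-- The generators `⊣ₐ` and `⊢ₐ` of the pluriassociative operad; for its Koszul dual they are
the generators `↼ₐ` and `⇀ₐ`. -/
inductive Gen (γ : ℕ) : Type
  | left (a : Fin γ) : Gen γ
  | right (a : Fin γ) : Gen γ

/-- Partial composition `u ∘ᵢ v` of words on the monoid `({0, …, γ}, max)`: the letter `uᵢ` of
`u` at position `i` is replaced by `v`, all of whose letters are multiplied by `uᵢ`. -/
def wordComp {γ : ℕ} (u : List (WithBot (Fin γ))) (i : ℕ) (v : List (WithBot (Fin γ))) :
    List (WithBot (Fin γ)) :=
  u.take i ++ v.map (fun c => u.getD i ⊥ ⊔ c) ++ u.drop (i + 1)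

/-- The generating words: `⊣ₐ` is `0a` and `⊢ₐ` is `a0`. -/
def Gen.word {γ : ℕ} : Gen γ → List (WithBot (Fin γ))
  | .left a => [⊥, (a : WithBot (Fin γ))]
  | .right a => [(a : WithBot (Fin γ)), ⊥]

/-- The operad morphism from the free operad to words extending `Gen.word`. Its image is the
`γ`-pluriassociative operad `Dias_γ`, the suboperad generated by the words `0a` and `a0`. -/
def diasWord {γ : ℕ} : SynTree (Gen γ) → List (WithBot (Fin γ))
  | .leaf => [⊥]
  | .node g l r => wordComp (wordComp g.word 1 (diasWord r)) 0 (diasWord l)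

/-- The space of (quadratic) relations of `Dias_γ`: the kernel, in arity `3`, of the morphism
from the free operad onto `Dias_γ`. -/
def diasRel (K : Type*) [Field K] (γ : ℕ) : Submodule K (FreeOperad K (Gen γ)) :=
  freeComponent K (Gen γ) 3 ⊓
    LinearMap.ker (Finsupp.lmapDomain K K (diasWord : SynTree (Gen γ) → _))

/-! ### The polydendriform operad -/

/-- The sign of a tree of arity `3`: `1` for `x ∘₁ y` and `-1` for `x ∘₂ y`. -/
def koszulSign (K : Type*) [Field K] {G : Type} : SynTree G → K
  | .node _ (.node _ .leaf .leaf) .leaf => 1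
  | .node _ .leaf (.node _ .leaf .leaf) => -1
  | _ => 0

/-- The bilinear form `⟨t, t'⟩ = koszulSign t` if `t = t'`, and `0` otherwise. -/
def koszulForm (K : Type*) [Field K] (G : Type) :
    FreeOperad K G →ₗ[K] FreeOperad K G →ₗ[K] K :=
  Finsupp.linearCombination K (fun t : SynTree G => koszulSign K t • Finsupp.lapply t)

/-- The space of relations of `Dendr_γ`, the Koszul dual of `Dias_γ`: the annihilator in arity
`3` of the space of relations of `Dias_γ`. Thus `Dendr_γ` is the quotient of the free operad
by `operadIdeal (dendrRel K γ)`. -/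
def dendrRel (K : Type*) [Field K] (γ : ℕ) : Submodule K (FreeOperad K (Gen γ)) where
  carrier := {x | x ∈ freeComponent K (Gen γ) 3 ∧ ∀ r ∈ diasRel K γ, koszulForm K (Gen γ) x r = 0}
  add_mem' := by
    rintro x y ⟨hx, hx'⟩ ⟨hy, hy'⟩
    exact ⟨add_mem hx hy, fun r hr => by simp [hx' r hr, hy' r hr]⟩
  zero_mem' := ⟨zero_mem _, fun r _ => by simp⟩
  smul_mem' := by
    rintro c x ⟨hx, hx'⟩
    exact ⟨Submodule.smul_mem _ c hx, fun r hr => by simp [hx' r hr]⟩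

/-- A `γ`-polydendriform algebra structure on a vector space `A`, that is, the structure of an
algebra over `Dendr_γ`: bilinear operations `↼ₐ = op (.left a)` and `⇀ₐ = op (.right a)` such
that every relation `r` of `Dendr_γ` satisfies `r(e₁, e₂, e₃) = 0`. -/
structure Algebra (K : Type*) [Field K] (γ : ℕ) (A : Type*) [AddCommGroup A] [Module K A] where
  op : Gen γ → A →ₗ[K] A →ₗ[K] A
  rel : ∀ r ∈ dendrRel K γ, ∀ e : ℕ → A, act op e r = 0

namespace Algebra

variable {K : Type*} [Field K] {γ : ℕ} {A : Type*} [AddCommGroup A] [Module K A]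

/-- `≺_b = ∑_{a ≤ b} ↼ₐ`. -/
def prec (S : Algebra K γ A) (b : Fin γ) : A →ₗ[K] A →ₗ[K] A :=
  ∑ a ∈ Finset.Iic b, S.op (.left a)

/-- `≻_b = ∑_{a ≤ b} ⇀ₐ`. -/
def succ (S : Algebra K γ A) (b : Fin γ) : A →ₗ[K] A →ₗ[K] A :=
  ∑ a ∈ Finset.Iic b, S.op (.right a)

/-- Morphisms of `γ`-polydendriform algebras. -/
def IsHom {B : Type*} [AddCommGroup B] [Module K B] (S : Algebra K γ A) (T : Algebra K γ B)
    (φ : A →ₗ[K] B) : Prop :=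
  ∀ (g : Gen γ) (x y : A), φ (S.op g x y) = T.op g (φ x) (φ y)

end Algebra

/-! ### Edge valued binary trees -/

/-- What hangs below a node: either a leaf, or an edge labeled by `x` leading to an internal
node with children `l` and `r`. -/
inductive Child (γ : ℕ) : Type
  | leaf : Child γ
  | edge (x : Fin γ) (l r : Child γ) : Child γ

/-- A `γ`-edge valued binary tree: a root, which is an internal node, and its two children.
Every edge between two internal nodes carries a label in `[γ]`. -/
structure EdgeTree (γ : ℕ) : Type where
  left : Child γ
  right : Child γ

/-- The number of internal nodes below. -/
def Child.size {γ : ℕ} : Child γ → ℕ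
  | leaf => 0
  | edge _ l r => l.size + r.size + 1

namespace EdgeTree

variable {γ : ℕ}

/-- The number of internal nodes. -/
def size (t : EdgeTree γ) : ℕ := t.left.size + t.right.size + 1

/-- The tree with exactly one internal node. -/
def one (γ : ℕ) : EdgeTree γ := ⟨.leaf, .leaf⟩

/-- The child consisting of an edge labeled `x` leading to the root of `t`. -/
def below (x : Fin γ) (t : EdgeTree γ) : Child γ := .edge x t.left t.right

end EdgeTree

/-- The vector space of `γ`-edge valued binary trees. -/
abbrev TreeSpace (K : Type*) [Field K] (γ : ℕ) : Type _ := EdgeTree γ →₀ K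

mutual

/-- The product `t ≺ₐ s` of two trees, by recursion on the right subtree `t₂` of `t` and the
label `y` of the edge above it. If `t₂` is a leaf then `y = ∞`, `t₂ ≺ₐ s = 0` and
`t₂ ≻_y s = s`. -/
def precTree (K : Type*) [Field K] {γ : ℕ} :
    Fin γ → EdgeTree γ → EdgeTree γ → TreeSpace K γ
  | a, ⟨t₁, .leaf⟩, s => Finsupp.single ⟨t₁, s.below a⟩ 1
  | a, ⟨t₁, .edge y l r⟩, s =>
      Finsupp.mapDomain (fun u : EdgeTree γ => ⟨t₁, u.below (min a y)⟩)
        (precTree K a ⟨l, r⟩ s + succTree K y ⟨l, r⟩ s)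
  termination_by _ t s => t.size + s.size
  decreasing_by all_goals (simp only [EdgeTree.size, Child.size]; omega)

/-- The product `s ≻ₐ t` of two trees, by recursion on the left subtree `t₁` of `t` and the
label `x` of the edge above it. If `t₁` is a leaf then `x = ∞`, `s ≻ₐ t₁ = 0` and
`s ≺_x t₁ = s`. -/
def succTree (K : Type*) [Field K] {γ : ℕ} :
    Fin γ → EdgeTree γ → EdgeTree γ → TreeSpace K γ
  | a, s, ⟨.leaf, t₂⟩ => Finsupp.single ⟨s.below a, t₂⟩ 1
  | a, s, ⟨.edge x l r, t₂⟩ =>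
      Finsupp.mapDomain (fun u : EdgeTree γ => ⟨u.below (min a x), t₂⟩)
        (succTree K a s ⟨l, r⟩ + precTree K x s ⟨l, r⟩)
  termination_by _ s t => s.size + t.size
  decreasing_by all_goals (simp only [EdgeTree.size, Child.size]; omega)

end

/-- Bilinear extension of a product of trees. -/
def bilinExt {K : Type*} [Field K] {γ : ℕ} (f : EdgeTree γ → EdgeTree γ → TreeSpace K γ) :
    TreeSpace K γ →ₗ[K] TreeSpace K γ →ₗ[K] TreeSpace K γ :=
  Finsupp.linearCombination K (fun t => Finsupp.linearCombination K (fun s => f t s))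

/-- The operation `≺ₐ` on the space of `γ`-edge valued binary trees. -/
def treePrec (K : Type*) [Field K] {γ : ℕ} (a : Fin γ) :
    TreeSpace K γ →ₗ[K] TreeSpace K γ →ₗ[K] TreeSpace K γ :=
  bilinExt (precTree K a)

/-- The operation `≻ₐ` on the space of `γ`-edge valued binary trees. -/
def treeSucc (K : Type*) [Field K] {γ : ℕ} (a : Fin γ) :
    TreeSpace K γ →ₗ[K] TreeSpace K γ →ₗ[K] TreeSpace K γ :=
  bilinExt (succTree K a)

end

end Polydendriform

namespace Polydendriform

noncomputable section

open Finsupp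

variable {K : Type*} [Field K] {γ : ℕ} {A : Type*} [AddCommGroup A] [Module K A]

/-! ### The relations of the polydendriform operad -/

-- Each tree of arity 3 goes to a single word in `Dias_γ`, so the relations of `Dias_γ` are spanned
-- by differences of trees with equal words. The annihilator for the signed form is then spanned,
-- word by word, by the sum of the left combs minus the sum of the right combs with that word
-- (`dendrRel_eq_span`). Reading off the words gives explicit relations between the `↼ₐ` and `⇀ₐ`.
-- Summing these over `p ≤ c`, `q ≤ d` turns the maxima of `Dias_γ` into minima (`sum_sum_sup_eq`)
-- and leaves three relations: `(x ≺_c y) ≺_d z = x ≺_{min c d} (y ≺_d z + y ≻_c z)`, `(x ≻_c y) ≺_d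
-- z = x ≻_c (y ≺_d z)`, and the mirror image of the first. Passing to partial sums is
-- unitriangular, so nothing is lost (`PrecSuccRel.exists_algebra`).
--
-- On edge valued trees the mixed relation holds because `≻` changes only the left child of the root
-- and `≺` only the right one. The two others follow by a simultaneous induction on the total size
-- (`tree_prec_prec_succ_succ`). Every tree arises from `•` by products `t ≻_x •` and `s ≺_y t`,
-- which forces its value in any algebra. That these values define a morphism is an induction in
-- which the recursion for the products mirrors the relations (`PrecSuccRel.lift_tree`).
--
-- For the kernel, the identities of an algebra form an operad ideal, which gives one inclusion.
-- Conversely, the free operad modulo `⟨R^⊥⟩` is itself an algebra, so the universal property sends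
-- `x(•, …, •)` to the class of `x`; if the former vanishes, so does the latter (`ker_act_eq`).

/-- Generators are indexed by two copies of `Fin γ`. -/
def Gen.equivSum (γ : ℕ) : Gen γ ≃ Fin γ ⊕ Fin γ where
  toFun
    | .left a => .inl a
    | .right a => .inr a
  invFun
    | .inl a => .left a
    | .inr a => .right a
  left_inv g := by cases g <;> rfl
  right_inv g := by cases g <;> rfl

instance : Fintype (Gen γ) := Fintype.ofEquiv _ (Gen.equivSum γ).symm

theorem Gen.sum_eq {M : Type*} [AddCommMonoid M] (f : Gen γ → M) :
    ∑ g, f g = ∑ a, f (.left a) + ∑ a, f (.right a) := by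
  rw [← (Gen.equivSum γ).symm.sum_comp, Fintype.sum_sum_type]
  rfl

-- Syntax trees with at most three leaves.

namespace SynTree

variable {G : Type}

/-- The tree `x ∘₁ y`. -/
def leftComb (x y : G) : SynTree G := .node x (.node y .leaf .leaf) .leaf

/-- The tree `x ∘₂ y`. -/
def rightComb (x y : G) : SynTree G := .node x .leaf (.node y .leaf .leaf)

theorem arity_pos (t : SynTree G) : 0 < t.arity := by
  induction t with
  | leaf => simp [arity]
  | node g l r hl hr => simp [arity]; omega

theorem eq_leaf_of_arity {t : SynTree G} (h : t.arity = 1) : t = .leaf := by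
  cases t with
  | leaf => rfl
  | node g l r =>
    have := l.arity_pos
    have := r.arity_pos
    simp only [arity] at h
    omega

theorem eq_node_of_arity {t : SynTree G} (h : t.arity = 2) : ∃ g, t = .node g .leaf .leaf := by
  cases t with
  | leaf => simp [arity] at h
  | node g l r =>
    have := l.arity_pos
    have := r.arity_pos
    simp only [arity] at h
    rw [eq_leaf_of_arity (t := l) (by omega), eq_leaf_of_arity (t := r) (by omega)]
    exact ⟨g, rfl⟩

theorem eq_comb_of_arity {t : SynTree G} (h : t.arity = 3) :
    (∃ x y, t = leftComb x y) ∨ ∃ x y, t = rightComb x y := by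
  cases t with
  | leaf => simp [arity] at h
  | node g l r =>
    have := l.arity_pos
    have := r.arity_pos
    simp only [arity] at h
    obtain h1 | h1 : l.arity = 1 ∨ l.arity = 2 := by omega
    · obtain ⟨y, rfl⟩ := eq_node_of_arity (t := r) (by omega)
      rw [eq_leaf_of_arity h1]
      exact .inr ⟨g, y, rfl⟩
    · obtain ⟨y, rfl⟩ := eq_node_of_arity h1
      rw [eq_leaf_of_arity (t := r) (by omega)]
      exact .inl ⟨g, y, rfl⟩

@[simp] theorem leftComb_inj {x y x' y' : G} :
    leftComb x y = leftComb x' y' ↔ x = x' ∧ y = y' := by simp [leftComb]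

@[simp] theorem rightComb_inj {x y x' y' : G} :
    rightComb x y = rightComb x' y' ↔ x = x' ∧ y = y' := by simp [rightComb]

@[simp] theorem leftComb_ne_rightComb {x y x' y' : G} : leftComb x y ≠ rightComb x' y' := by
  simp [leftComb, rightComb]

@[simp] theorem rightComb_ne_leftComb {x y x' y' : G} : rightComb x y ≠ leftComb x' y' := by
  simp [leftComb, rightComb]

@[simp] theorem arity_leftComb (x y : G) : (leftComb x y).arity = 3 := rfl

@[simp] theorem arity_rightComb (x y : G) : (rightComb x y).arity = 3 := rfl

end SynTree

open SynTree

@[simp] theorem koszulSign_leftComb {G : Type} (x y : G) : koszulSign K (leftComb x y) = 1 := rfl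

@[simp] theorem koszulSign_rightComb {G : Type} (x y : G) :
    koszulSign K (rightComb x y) = -1 := rfl

-- The bilinear form in arity 3 and its annihilators.

theorem koszulForm_single {G : Type} (t : SynTree G) (c : K) (r : FreeOperad K G) :
    koszulForm K G (single t c) r = c * (koszulSign K t * r t) := by
  simp [koszulForm]

theorem single_mem_freeComponent {G : Type} {t : SynTree G} {n : ℕ} (h : t.arity = n) (c : K) :
    single t c ∈ freeComponent K G n :=
  Finsupp.single_mem_supported K c h

theorem eq_sum_comb {r : FreeOperad K (Gen γ)} (hr : r ∈ freeComponent K (Gen γ) 3) :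
    r = ∑ x, ∑ y, (single (leftComb x y) (r (leftComb x y)) +
      single (rightComb x y) (r (rightComb x y))) := by
  classical
  ext t
  by_cases ht : t.arity = 3
  · obtain ⟨x, y, rfl⟩ | ⟨x, y, rfl⟩ := eq_comb_of_arity ht <;>
    simp [Finsupp.finsetSum_apply, Finsupp.single_apply, ite_and]
  · have h0 : r t = 0 := by
      by_contra h
      exact ht (hr (Finsupp.mem_support_iff.2 h))
    rw [h0]
    simp only [Finsupp.finsetSum_apply, Finsupp.add_apply]
    refine (Finset.sum_eq_zero fun x _ => Finset.sum_eq_zero fun y _ => ?_).symm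
    rw [Finsupp.single_eq_of_ne, Finsupp.single_eq_of_ne, add_zero] <;>
    · rintro rfl
      simp at ht

/-- The signed sum of the trees of arity `3` with a given image in `Dias_γ`. -/
def classRel (K : Type*) [Field K] {γ : ℕ} (w : List (WithBot (Fin γ))) :
    FreeOperad K (Gen γ) :=
  ∑ x, ∑ y, ((if diasWord (leftComb x y) = w then single (leftComb x y) 1 else 0) -
    if diasWord (rightComb x y) = w then single (rightComb x y) 1 else 0)

/-- The signs of the form cancel those of `classRel`, so pairing with `r` gives the coefficient of
`w` in the image of `r`, which is zero on the kernel. -/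
theorem classRel_mem (w : List (WithBot (Fin γ))) : classRel K w ∈ dendrRel K γ := by
  constructor
  · refine Submodule.sum_mem _ fun x _ => Submodule.sum_mem _ fun y _ => ?_
    refine Submodule.sub_mem _ ?_ ?_ <;> split_ifs
    · exact single_mem_freeComponent rfl _
    · exact zero_mem _
    · exact single_mem_freeComponent rfl _
    · exact zero_mem _
  · rintro r ⟨hr, hr'⟩
    have h := DFunLike.congr_fun (LinearMap.mem_ker.1 hr') w
    rw [eq_sum_comb hr] at h
    simp only [map_sum, map_add, Finsupp.lmapDomain_apply, Finsupp.mapDomain_single,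
      Finsupp.finsetSum_apply, Finsupp.add_apply, Finsupp.single_apply,
      Finsupp.coe_zero, Pi.zero_apply] at h
    rw [← h]
    simp only [classRel, map_sum, map_sub, LinearMap.sum_apply, LinearMap.sub_apply]
    refine Finset.sum_congr rfl fun x _ => Finset.sum_congr rfl fun y _ => ?_
    split_ifs <;> simp [koszulForm_single]

/-- The difference of two trees with the same word is a relation of `Dias_γ`; pair `x` with it. -/
theorem koszulSign_mul_eq {x : FreeOperad K (Gen γ)} (hx : x ∈ dendrRel K γ)
    {t t' : SynTree (Gen γ)} (ht : t.arity = 3) (ht' : t'.arity = 3)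
    (h : diasWord t = diasWord t') : koszulSign K t * x t = koszulSign K t' * x t' := by
  classical
  have hform : ∀ s, koszulForm K (Gen γ) x (single s 1) = koszulSign K s * x s := by
    intro s
    conv_lhs => rw [← Finsupp.sum_single x]
    rw [Finsupp.sum, map_sum, LinearMap.sum_apply]
    simp only [koszulForm_single, Finsupp.single_apply]
    rw [Finset.sum_eq_single s]
    · simp [mul_comm]
    · intro b _ hb
      simp [Ne.symm hb]
    · intro hs
      simp [Finsupp.notMem_support_iff.1 hs]
  have h0 := hx.2 (single t 1 - single t' 1)
    ⟨Submodule.sub_mem _ (single_mem_freeComponent ht _) (single_mem_freeComponent ht' _), by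
      rw [SetLike.mem_coe, LinearMap.mem_ker, map_sub, Finsupp.lmapDomain_apply, Finsupp.lmapDomain_apply,
        Finsupp.mapDomain_single, Finsupp.mapDomain_single, h, sub_self]⟩
  rw [map_sub, hform, hform] at h0
  exact sub_eq_zero.1 h0

/-- Up to sign, the coefficients of an element of the annihilator depend only on the word of the
tree, so it is a combination of the signed sums over the fibres of `diasWord`. -/
theorem dendrRel_eq_span :
    dendrRel K γ = Submodule.span K (Set.range (classRel K (γ := γ))) := by
  classical
  apply le_antisymm
  · intro x hx
    -- The common signed coefficient of the trees with word `w`, read on a chosen one;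
    -- `koszulSign_mul_eq` makes the choice harmless.
    let f : List (WithBot (Fin γ)) → K := fun w =>
      if h : ∃ t : SynTree (Gen γ), t.arity = 3 ∧ diasWord t = w then
        koszulSign K h.choose * x h.choose else 0
    have hf : ∀ t : SynTree (Gen γ), t.arity = 3 → f (diasWord t) = koszulSign K t * x t := by
      intro t ht
      have h : ∃ t' : SynTree (Gen γ), t'.arity = 3 ∧ diasWord t' = diasWord t := ⟨t, ht, rfl⟩
      simp only [f, dif_pos h]
      exact koszulSign_mul_eq hx h.choose_spec.1 ht h.choose_spec.2
    obtain ⟨W, hW⟩ : ∃ W : Finset (List (WithBot (Fin γ))), ∀ a b,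
        diasWord (leftComb a b) ∈ W ∧ diasWord (rightComb a b) ∈ W :=
      ⟨Finset.univ.biUnion fun a => Finset.univ.biUnion fun b =>
        {diasWord (leftComb a b), diasWord (rightComb a b)}, fun a b => by
          simp only [Finset.mem_biUnion, Finset.mem_univ, true_and, Finset.mem_insert,
            Finset.mem_singleton]
          exact ⟨⟨a, b, .inl rfl⟩, ⟨a, b, .inr rfl⟩⟩⟩
    have key : x = ∑ w ∈ W, f w • classRel K w := by
      conv_lhs => rw [eq_sum_comb hx.1]
      simp only [classRel, Finset.smul_sum]
      rw [Finset.sum_comm (s := W)]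
      refine Finset.sum_congr rfl fun a _ => ?_
      rw [Finset.sum_comm (s := W)]
      refine Finset.sum_congr rfl fun b _ => ?_
      simp only [smul_sub, smul_ite, smul_zero, Finset.sum_sub_distrib, Finset.sum_ite_eq,
        (hW a b).1, (hW a b).2, if_true]
      rw [hf _ (arity_leftComb a b), hf _ (arity_rightComb a b)]
      simp
    rw [key]
    exact Submodule.sum_mem _ fun w _ => Submodule.smul_mem _ _ (Submodule.subset_span ⟨w, rfl⟩)
  · rw [Submodule.span_le]
    rintro _ ⟨w, rfl⟩
    exact classRel_mem w

/-- The relations of `Dendr_γ` for the operations `↼ₐ` and `⇀ₐ`. -/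
structure OpRel (op : Gen γ → A →ₗ[K] A →ₗ[K] A) : Prop where
  left_left : ∀ p q x y z, op (.left q) (op (.left p) x y) z =
    ∑ b, (if p ⊔ b = q then op (.left p) x (op (.left b) y z) else 0) +
      ∑ b, if q ⊔ b = p then op (.left q) x (op (.right b) y z) else 0
  right_left : ∀ p q x y z, op (.left q) (op (.right p) x y) z =
    op (.right p) x (op (.left q) y z)
  right_right : ∀ p q x y z, op (.right p) x (op (.right q) y z) =
    ∑ b, (if p ⊔ b = q then op (.right p) (op (.left b) x y) z else 0) +
      ∑ b, if q ⊔ b = p then op (.right q) (op (.right b) x y) z else 0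

theorem act_classRel (op : Gen γ → A →ₗ[K] A →ₗ[K] A) (e : ℕ → A)
    (w : List (WithBot (Fin γ))) :
    act op e (classRel K w) = ∑ x, ∑ y,
      ((if diasWord (leftComb x y) = w then op x (op y (e 0) (e 1)) (e 2) else 0) -
        if diasWord (rightComb x y) = w then op x (e 0) (op y (e 1) (e 2)) else 0) := by
  simp only [classRel, map_sum, map_sub]
  refine Finset.sum_congr rfl fun x _ => Finset.sum_congr rfl fun y _ => ?_
  split_ifs <;> simp [act, leftComb, rightComb, evalAt, arity]

-- The eight families of words of arity 3 and the resulting relations.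

theorem diasWord_leftComb_left_left (a b : Fin γ) :
    diasWord (leftComb (.left a) (.left b)) = [⊥, (b : WithBot (Fin γ)), (a : WithBot (Fin γ))] := by
  simp [leftComb, diasWord, wordComp, Gen.word]

theorem diasWord_leftComb_left_right (a b : Fin γ) :
    diasWord (leftComb (.left a) (.right b)) = [(b : WithBot (Fin γ)), ⊥, (a : WithBot (Fin γ))] := by
  simp [leftComb, diasWord, wordComp, Gen.word]

theorem diasWord_leftComb_right_left (a b : Fin γ) :
    diasWord (leftComb (.right a) (.left b)) =
      [(a : WithBot (Fin γ)), ((a ⊔ b : Fin γ) : WithBot (Fin γ)), ⊥] := by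
  simp [leftComb, diasWord, wordComp, Gen.word]

theorem diasWord_leftComb_right_right (a b : Fin γ) :
    diasWord (leftComb (.right a) (.right b)) =
      [((a ⊔ b : Fin γ) : WithBot (Fin γ)), (a : WithBot (Fin γ)), ⊥] := by
  simp [leftComb, diasWord, wordComp, Gen.word]

theorem diasWord_rightComb_left_left (a b : Fin γ) :
    diasWord (rightComb (.left a) (.left b)) =
      [⊥, (a : WithBot (Fin γ)), ((a ⊔ b : Fin γ) : WithBot (Fin γ))] := by
  simp [rightComb, diasWord, wordComp, Gen.word]

theorem diasWord_rightComb_left_right (a b : Fin γ) :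
    diasWord (rightComb (.left a) (.right b)) =
      [⊥, ((a ⊔ b : Fin γ) : WithBot (Fin γ)), (a : WithBot (Fin γ))] := by
  simp [rightComb, diasWord, wordComp, Gen.word]

theorem diasWord_rightComb_right_left (a b : Fin γ) :
    diasWord (rightComb (.right a) (.left b)) =
      [(a : WithBot (Fin γ)), ⊥, (b : WithBot (Fin γ))] := by
  simp [rightComb, diasWord, wordComp, Gen.word]

theorem diasWord_rightComb_right_right (a b : Fin γ) :
    diasWord (rightComb (.right a) (.right b)) =
      [(a : WithBot (Fin γ)), (b : WithBot (Fin γ)), ⊥] := by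
  simp [rightComb, diasWord, wordComp, Gen.word]

theorem act_classRel_expand (op : Gen γ → A →ₗ[K] A →ₗ[K] A) (e : ℕ → A)
    (w : List (WithBot (Fin γ))) :
    act op e (classRel K w) =
      (∑ a : Fin γ, ∑ b : Fin γ, if [⊥, (b : WithBot (Fin γ)), (a : WithBot (Fin γ))] = w then
        op (.left a) (op (.left b) (e 0) (e 1)) (e 2) else 0) +
      (∑ a : Fin γ, ∑ b : Fin γ, if [(b : WithBot (Fin γ)), ⊥, (a : WithBot (Fin γ))] = w then
        op (.left a) (op (.right b) (e 0) (e 1)) (e 2) else 0) +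
      (∑ a : Fin γ, ∑ b : Fin γ, if [(a : WithBot (Fin γ)), ((a ⊔ b : Fin γ) : WithBot (Fin γ)), ⊥] = w then
        op (.right a) (op (.left b) (e 0) (e 1)) (e 2) else 0) +
      (∑ a : Fin γ, ∑ b : Fin γ, if [((a ⊔ b : Fin γ) : WithBot (Fin γ)), (a : WithBot (Fin γ)), ⊥] = w then
        op (.right a) (op (.right b) (e 0) (e 1)) (e 2) else 0) -
      (∑ a : Fin γ, ∑ b : Fin γ, if [⊥, (a : WithBot (Fin γ)), ((a ⊔ b : Fin γ) : WithBot (Fin γ))] = w then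
        op (.left a) (e 0) (op (.left b) (e 1) (e 2)) else 0) -
      (∑ a : Fin γ, ∑ b : Fin γ, if [⊥, ((a ⊔ b : Fin γ) : WithBot (Fin γ)), (a : WithBot (Fin γ))] = w then
        op (.left a) (e 0) (op (.right b) (e 1) (e 2)) else 0) -
      (∑ a : Fin γ, ∑ b : Fin γ, if [(a : WithBot (Fin γ)), ⊥, (b : WithBot (Fin γ))] = w then
        op (.right a) (e 0) (op (.left b) (e 1) (e 2)) else 0) -
      (∑ a : Fin γ, ∑ b : Fin γ, if [(a : WithBot (Fin γ)), (b : WithBot (Fin γ)), ⊥] = w then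
        op (.right a) (e 0) (op (.right b) (e 1) (e 2)) else 0) := by
  rw [act_classRel]
  simp only [Gen.sum_eq, diasWord_leftComb_left_left, diasWord_leftComb_left_right,
    diasWord_leftComb_right_left, diasWord_leftComb_right_right, diasWord_rightComb_left_left,
    diasWord_rightComb_left_right, diasWord_rightComb_right_left,
    diasWord_rightComb_right_right, Finset.sum_sub_distrib, Finset.sum_add_distrib]
  abel

theorem act_classRel_left (op : Gen γ → A →ₗ[K] A →ₗ[K] A) (e : ℕ → A) (p q : Fin γ) :
    act op e (classRel K [⊥, (p : WithBot (Fin γ)), (q : WithBot (Fin γ))]) =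
      op (.left q) (op (.left p) (e 0) (e 1)) (e 2) -
        (∑ b, (if p ⊔ b = q then op (.left p) (e 0) (op (.left b) (e 1) (e 2)) else 0) +
          ∑ b, if q ⊔ b = p then op (.left q) (e 0) (op (.right b) (e 1) (e 2)) else 0) := by
  rw [act_classRel_expand]
  simp only [List.cons.injEq, WithBot.coe_inj, WithBot.coe_ne_bot, WithBot.bot_ne_coe, true_and,
    and_true, false_and, and_false, if_false, Finset.sum_const_zero, ite_and]
  -- Putting `a = q` outermost lets the sum over `a` collapse to a single term.
  have h : ∀ a b : Fin γ, ((a ⊔ b = p : Prop) ∧ a = q) ↔ (a = q ∧ a ⊔ b = p) := fun _ _ => and_comm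
  simp only [← ite_and, h]
  simp only [ite_and, Finset.sum_ite_eq', Finset.mem_univ, if_true,
    Finset.sum_ite_irrel, Finset.sum_const_zero]
  abel

theorem act_classRel_middle (op : Gen γ → A →ₗ[K] A →ₗ[K] A) (e : ℕ → A) (p q : Fin γ) :
    act op e (classRel K [(p : WithBot (Fin γ)), ⊥, (q : WithBot (Fin γ))]) =
      op (.left q) (op (.right p) (e 0) (e 1)) (e 2) -
        op (.right p) (e 0) (op (.left q) (e 1) (e 2)) := by
  rw [act_classRel_expand]
  simp only [List.cons.injEq, WithBot.coe_inj, WithBot.coe_ne_bot, WithBot.bot_ne_coe, true_and,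
    and_true, false_and, and_false, if_false, Finset.sum_const_zero, ite_and,
    Finset.sum_ite_eq', Finset.mem_univ, if_true,
    Finset.sum_ite_irrel]
  abel

theorem act_classRel_right (op : Gen γ → A →ₗ[K] A →ₗ[K] A) (e : ℕ → A) (p q : Fin γ) :
    act op e (classRel K [(p : WithBot (Fin γ)), (q : WithBot (Fin γ)), ⊥]) =
        (∑ b, (if p ⊔ b = q then op (.right p) (op (.left b) (e 0) (e 1)) (e 2) else 0) +
          ∑ b, if q ⊔ b = p then op (.right q) (op (.right b) (e 0) (e 1)) (e 2) else 0) -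
      op (.right p) (e 0) (op (.right q) (e 1) (e 2)) := by
  rw [act_classRel_expand]
  simp only [List.cons.injEq, WithBot.coe_inj, WithBot.coe_ne_bot, WithBot.bot_ne_coe,
    and_true, and_false, if_false, Finset.sum_const_zero, ite_and]
  have h : ∀ a b : Fin γ, ((a ⊔ b = p : Prop) ∧ a = q) ↔ (a = q ∧ a ⊔ b = p) := fun _ _ => and_comm
  simp only [← ite_and, h]
  simp only [ite_and, Finset.sum_ite_eq', Finset.mem_univ, if_true,
    Finset.sum_ite_irrel, Finset.sum_const_zero]
  abel

theorem Algebra.opRel (S : Algebra K γ A) : OpRel S.op where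
  left_left p q x y z := by
    have h := S.rel _ (classRel_mem [⊥, (p : WithBot (Fin γ)), (q : WithBot (Fin γ))])
      (fun n => if n = 0 then x else if n = 1 then y else z)
    rw [act_classRel_left] at h
    simpa using sub_eq_zero.1 h
  right_left p q x y z := by
    have h := S.rel _ (classRel_mem [(p : WithBot (Fin γ)), ⊥, (q : WithBot (Fin γ))])
      (fun n => if n = 0 then x else if n = 1 then y else z)
    rw [act_classRel_middle] at h
    simpa using sub_eq_zero.1 h
  right_right p q x y z := by
    have h := S.rel _ (classRel_mem [(p : WithBot (Fin γ)), (q : WithBot (Fin γ)), ⊥])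
      (fun n => if n = 0 then x else if n = 1 then y else z)
    rw [act_classRel_right] at h
    simpa using (sub_eq_zero.1 h).symm

theorem OpRel.act_eq_zero {op : Gen γ → A →ₗ[K] A →ₗ[K] A} (h : OpRel op)
    {r : FreeOperad K (Gen γ)} (hr : r ∈ dendrRel K γ) (e : ℕ → A) : act op e r = 0 := by
  rw [dendrRel_eq_span] at hr
  suffices Submodule.span K (Set.range (classRel K)) ≤ LinearMap.ker (act op e) from this hr
  rw [Submodule.span_le]
  rintro _ ⟨w, rfl⟩
  simp only [SetLike.mem_coe, LinearMap.mem_ker]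
  by_cases h1 : ∃ p q : Fin γ, w = [⊥, (p : WithBot (Fin γ)), (q : WithBot (Fin γ))]
  · obtain ⟨p, q, rfl⟩ := h1
    rw [act_classRel_left, h.left_left, sub_self]
  by_cases h2 : ∃ p q : Fin γ, w = [(p : WithBot (Fin γ)), ⊥, (q : WithBot (Fin γ))]
  · obtain ⟨p, q, rfl⟩ := h2
    rw [act_classRel_middle, h.right_left, sub_self]
  by_cases h3 : ∃ p q : Fin γ, w = [(p : WithBot (Fin γ)), (q : WithBot (Fin γ)), ⊥]
  · obtain ⟨p, q, rfl⟩ := h3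
    rw [act_classRel_right, h.right_right, sub_self]
  -- No tree of arity 3 has a word of another shape, so all the sums are empty.
  push Not at h1 h2 h3
  rw [act_classRel_expand]
  simp only [Ne.symm (h1 _ _), Ne.symm (h2 _ _), Ne.symm (h3 _ _), if_false,
    Finset.sum_const_zero, add_zero, sub_zero]

/-! ### The operations `≺` and `≻` -/

/-- The relations of polydendriform algebras for the operations `≺_b` and `≻_b`. -/
structure PrecSuccRel (P S : Fin γ → A →ₗ[K] A →ₗ[K] A) : Prop where
  prec_prec : ∀ c d x y z, P d (P c x y) z = P (min c d) x (P d y z + S c y z)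
  succ_prec : ∀ c d x y z, P d (S c x y) z = S c x (P d y z)
  succ_succ : ∀ c d x y z, S c x (S d y z) = S (min c d) (P d x y + S c x y) z

/-- Partial summation is unitriangular: once the earlier terms vanish, the sum up to `a` is `F a`.
-/
theorem eq_zero_of_sum_Iic {M : Type*} [AddCommMonoid M] {F : Fin γ → M}
    (h : ∀ c, ∑ a ∈ Finset.Iic c, F a = 0) (a : Fin γ) : F a = 0 := by
  induction a using WellFoundedLT.induction with
  | ind a ih =>
    have := h a
    rwa [Finset.sum_eq_single_of_mem a (by simp) fun b hb hne =>
      ih b (lt_of_le_of_ne (Finset.mem_Iic.1 hb) hne)] at this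

/-- Inverts partial summation by the recursion `F a = P a - ∑_{b < a} F b`. -/
theorem exists_sum_Iic_eq {M : Type*} [AddCommGroup M] (P : Fin γ → M) :
    ∃ F : Fin γ → M, ∀ c, ∑ a ∈ Finset.Iic c, F a = P c := by
  let F : Fin γ → M := WellFoundedLT.fix fun a ih =>
    P a - ∑ b : {b // b ∈ Finset.Iio a}, ih b.1 (Finset.mem_Iio.1 b.2)
  refine ⟨F, fun c => ?_⟩
  have hF : F c = P c - ∑ b ∈ Finset.Iio c, F b := by
    rw [← Finset.sum_coe_sort]
    exact WellFoundedLT.fix_eq _ c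
  rw [← Finset.Iio_insert, Finset.sum_insert (by simp), hF, sub_add_cancel]

/-- Here `q` is determined by `p` and `b`, and `p ⊔ b ≤ d` means `p ≤ d` and `b ≤ d`. Together with
`p ≤ c` this is the origin of `min c d`. -/
theorem sum_sum_sup_eq {M : Type*} [AddCommMonoid M] (G : Fin γ → Fin γ → M) (c d : Fin γ) :
    ∑ p ∈ Finset.Iic c, ∑ q ∈ Finset.Iic d, ∑ b, (if p ⊔ b = q then G p b else 0) =
      ∑ p ∈ Finset.Iic (min c d), ∑ b ∈ Finset.Iic d, G p b := by
  have h1 : ∀ p, ∑ q ∈ Finset.Iic d, ∑ b, (if p ⊔ b = q then G p b else 0) =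
      if p ≤ d then ∑ b ∈ Finset.Iic d, G p b else 0 := by
    intro p
    rw [Finset.sum_comm]
    simp only [Finset.sum_ite_eq, Finset.mem_Iic, sup_le_iff, ite_and]
    rw [Finset.sum_ite_irrel, Finset.sum_const_zero, ← Finset.sum_filter,
      Finset.filter_ge_eq_Iic]
  rw [Finset.sum_congr rfl fun p _ => h1 p, ← Finset.sum_filter]
  refine Finset.sum_congr ?_ fun _ _ => rfl
  ext p
  simp

theorem sum_sum_sup_eq' {M : Type*} [AddCommMonoid M] (G : Fin γ → Fin γ → M) (c d : Fin γ) :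
    ∑ p ∈ Finset.Iic c, ∑ q ∈ Finset.Iic d, ∑ b, (if q ⊔ b = p then G q b else 0) =
      ∑ q ∈ Finset.Iic (min c d), ∑ b ∈ Finset.Iic c, G q b := by
  rw [Finset.sum_comm, sum_sum_sup_eq, min_comm]

theorem sum_op_sum_left {ι κ : Type*} (s : Finset ι) (t : Finset κ) (f : ι → A →ₗ[K] A →ₗ[K] A)
    (g : κ → A →ₗ[K] A →ₗ[K] A) (x y z : A) :
    (∑ i ∈ s, f i) ((∑ j ∈ t, g j) x y) z = ∑ j ∈ t, ∑ i ∈ s, f i (g j x y) z := by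
  simp only [LinearMap.sum_apply, map_sum]

theorem sum_op_sum_right {ι κ : Type*} (s : Finset ι) (t : Finset κ) (f : ι → A →ₗ[K] A →ₗ[K] A)
    (g : κ → A →ₗ[K] A →ₗ[K] A) (x y z : A) :
    (∑ i ∈ s, f i) x ((∑ j ∈ t, g j) y z) = ∑ i ∈ s, ∑ j ∈ t, f i x (g j y z) := by
  simp only [LinearMap.sum_apply, map_sum]
  rw [Finset.sum_comm]

/-- Stated for the defects of the relations and for arbitrary operations, so that it serves both to
derive the relations of `≺`, `≻` and, after inversion of the sums, to recover those of `↼`, `⇀`. -/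
theorem sum_Iic_prec_prec (op : Gen γ → A →ₗ[K] A →ₗ[K] A) (c d : Fin γ) (x y z : A) :
    ∑ p ∈ Finset.Iic c, ∑ q ∈ Finset.Iic d, (op (.left q) (op (.left p) x y) z -
      (∑ b, (if p ⊔ b = q then op (.left p) x (op (.left b) y z) else 0) +
        ∑ b, if q ⊔ b = p then op (.left q) x (op (.right b) y z) else 0)) =
    (∑ a ∈ Finset.Iic d, op (.left a)) ((∑ a ∈ Finset.Iic c, op (.left a)) x y) z -
      (∑ a ∈ Finset.Iic (min c d), op (.left a)) x ((∑ a ∈ Finset.Iic d, op (.left a)) y z +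
        (∑ a ∈ Finset.Iic c, op (.right a)) y z) := by
  simp only [Finset.sum_sub_distrib, Finset.sum_add_distrib]
  rw [sum_sum_sup_eq (fun p b => op (.left p) x (op (.left b) y z)),
    sum_sum_sup_eq' (fun p b => op (.left p) x (op (.right b) y z)), map_add, sum_op_sum_left,
    sum_op_sum_right, sum_op_sum_right]

theorem sum_Iic_succ_prec (op : Gen γ → A →ₗ[K] A →ₗ[K] A) (c d : Fin γ) (x y z : A) :
    ∑ p ∈ Finset.Iic c, ∑ q ∈ Finset.Iic d, (op (.left q) (op (.right p) x y) z -
      op (.right p) x (op (.left q) y z)) =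
    (∑ a ∈ Finset.Iic d, op (.left a)) ((∑ a ∈ Finset.Iic c, op (.right a)) x y) z -
      (∑ a ∈ Finset.Iic c, op (.right a)) x ((∑ a ∈ Finset.Iic d, op (.left a)) y z) := by
  simp only [Finset.sum_sub_distrib]
  rw [sum_op_sum_left, sum_op_sum_right]

theorem sum_Iic_succ_succ (op : Gen γ → A →ₗ[K] A →ₗ[K] A) (c d : Fin γ) (x y z : A) :
    ∑ p ∈ Finset.Iic c, ∑ q ∈ Finset.Iic d, (op (.right p) x (op (.right q) y z) -
      (∑ b, (if p ⊔ b = q then op (.right p) (op (.left b) x y) z else 0) +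
        ∑ b, if q ⊔ b = p then op (.right q) (op (.right b) x y) z else 0)) =
    (∑ a ∈ Finset.Iic c, op (.right a)) x ((∑ a ∈ Finset.Iic d, op (.right a)) y z) -
      (∑ a ∈ Finset.Iic (min c d), op (.right a)) ((∑ a ∈ Finset.Iic d, op (.left a)) x y +
        (∑ a ∈ Finset.Iic c, op (.right a)) x y) z := by
  simp only [Finset.sum_sub_distrib, Finset.sum_add_distrib]
  rw [sum_sum_sup_eq (fun p b => op (.right p) (op (.left b) x y) z),
    sum_sum_sup_eq' (fun p b => op (.right p) (op (.right b) x y) z),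
    map_add, LinearMap.add_apply, sum_op_sum_right, sum_op_sum_left, sum_op_sum_left,
    Finset.sum_comm (s := Finset.Iic d) (t := Finset.Iic (min c d)),
    Finset.sum_comm (s := Finset.Iic c) (t := Finset.Iic (min c d))]

theorem Algebra.precSuccRel (S : Algebra K γ A) : PrecSuccRel S.prec S.succ where
  prec_prec c d x y z := by
    have h := sum_Iic_prec_prec S.op c d x y z
    simp only [← S.opRel.left_left, sub_self, Finset.sum_const_zero] at h
    exact sub_eq_zero.1 h.symm
  succ_prec c d x y z := by
    have h := sum_Iic_succ_prec S.op c d x y z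
    simp only [← S.opRel.right_left, sub_self, Finset.sum_const_zero] at h
    exact sub_eq_zero.1 h.symm
  succ_succ c d x y z := by
    have h := sum_Iic_succ_succ S.op c d x y z
    simp only [← S.opRel.right_right, sub_self, Finset.sum_const_zero] at h
    exact sub_eq_zero.1 h.symm

theorem eq_of_sum_Iic {M : Type*} [AddCommGroup M] {F G : Fin γ → Fin γ → M}
    (h : ∀ c d, ∑ p ∈ Finset.Iic c, ∑ q ∈ Finset.Iic d, (F p q - G p q) = 0) (p q : Fin γ) :
    F p q = G p q :=
  sub_eq_zero.1 (eq_zero_of_sum_Iic (fun d => eq_zero_of_sum_Iic (fun c => h c d) p) q)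

theorem PrecSuccRel.exists_algebra {P S : Fin γ → A →ₗ[K] A →ₗ[K] A} (h : PrecSuccRel P S) :
    ∃ T : Algebra K γ A, T.prec = P ∧ T.succ = S := by
  obtain ⟨F, hF⟩ := exists_sum_Iic_eq P
  obtain ⟨G, hG⟩ := exists_sum_Iic_eq S
  let op : Gen γ → A →ₗ[K] A →ₗ[K] A
    | .left a => F a
    | .right a => G a
  have hP : ∀ c, ∑ a ∈ Finset.Iic c, op (.left a) = P c := hF
  have hS : ∀ c, ∑ a ∈ Finset.Iic c, op (.right a) = S c := hG
  have hop : OpRel op :=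
    { left_left := fun p q x y z => eq_of_sum_Iic
        (F := fun p q => op (.left q) (op (.left p) x y) z)
        (G := fun p q => ∑ b, (if p ⊔ b = q then op (.left p) x (op (.left b) y z) else 0) +
          ∑ b, if q ⊔ b = p then op (.left q) x (op (.right b) y z) else 0) (fun c d => by
        rw [sum_Iic_prec_prec]
        simp only [hP, hS]
        exact sub_eq_zero.2 (h.prec_prec c d x y z)) p q
      right_left := fun p q x y z => eq_of_sum_Iic
        (F := fun p q => op (.left q) (op (.right p) x y) z)
        (G := fun p q => op (.right p) x (op (.left q) y z)) (fun c d => by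
        rw [sum_Iic_succ_prec]
        simp only [hP, hS]
        exact sub_eq_zero.2 (h.succ_prec c d x y z)) p q
      right_right := fun p q x y z => eq_of_sum_Iic
        (F := fun p q => op (.right p) x (op (.right q) y z))
        (G := fun p q => ∑ b, (if p ⊔ b = q then op (.right p) (op (.left b) x y) z else 0) +
          ∑ b, if q ⊔ b = p then op (.right q) (op (.right b) x y) z else 0) (fun c d => by
        rw [sum_Iic_succ_succ]
        simp only [hP, hS]
        exact sub_eq_zero.2 (h.succ_succ c d x y z)) p q }
  exact ⟨⟨op, fun r hr e => hop.act_eq_zero hr e⟩, funext hP, funext hS⟩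

theorem Algebra.IsHom.of_prec_succ {B : Type*} [AddCommGroup B] [Module K B]
    {S : Algebra K γ A} {T : Algebra K γ B} {φ : A →ₗ[K] B}
    (hP : ∀ a x y, φ (S.prec a x y) = T.prec a (φ x) (φ y))
    (hS : ∀ a x y, φ (S.succ a x y) = T.succ a (φ x) (φ y)) : S.IsHom T φ := by
  rintro (a | a) x y
  · refine sub_eq_zero.1 (eq_zero_of_sum_Iic
      (F := fun a => φ (S.op (.left a) x y) - T.op (.left a) (φ x) (φ y)) (fun c => ?_) a)
    simpa [Algebra.prec, LinearMap.sum_apply] using sub_eq_zero.2 (hP c x y)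
  · refine sub_eq_zero.1 (eq_zero_of_sum_Iic
      (F := fun a => φ (S.op (.right a) x y) - T.op (.right a) (φ x) (φ y)) (fun c => ?_) a)
    simpa [Algebra.succ, LinearMap.sum_apply] using sub_eq_zero.2 (hS c x y)

theorem Algebra.IsHom.map_prec {B : Type*} [AddCommGroup B] [Module K B]
    {S : Algebra K γ A} {T : Algebra K γ B} {φ : A →ₗ[K] B} (h : S.IsHom T φ) (a : Fin γ)
    (x y : A) : φ (S.prec a x y) = T.prec a (φ x) (φ y) := by
  simp [Algebra.prec, LinearMap.sum_apply, h _ x y]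

theorem Algebra.IsHom.map_succ {B : Type*} [AddCommGroup B] [Module K B]
    {S : Algebra K γ A} {T : Algebra K γ B} {φ : A →ₗ[K] B} (h : S.IsHom T φ) (a : Fin γ)
    (x y : A) : φ (S.succ a x y) = T.succ a (φ x) (φ y) := by
  simp [Algebra.succ, LinearMap.sum_apply, h _ x y]

/-! ### The relations on edge valued binary trees -/

namespace EdgeTree

/-- Every edge valued tree is built from the tree with one node by hanging trees from it. -/
theorem hang_induction {p : EdgeTree γ → Prop} (one : p (EdgeTree.one γ))
    (hang_left : ∀ x t, p t → p ⟨t.below x, .leaf⟩)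
    (hang_right : ∀ l y t, p ⟨l, .leaf⟩ → p t → p ⟨l, t.below y⟩) (t : EdgeTree γ) : p t := by
  -- The recursion runs over children. A child is used in two ways: as an edge with a tree below it,
  -- and as the left child of a root whose right child is a leaf; both must be carried along.
  have h1 : ∀ c : Child γ, (∀ x l r, c = .edge x l r → p ⟨l, r⟩) ∧ p ⟨c, .leaf⟩ := by
    intro c
    induction c with
    | leaf => exact ⟨fun x l r h => by simp at h, one⟩
    | edge x l r hl hr =>
      have hp : p ⟨l, r⟩ := by
        cases r with
        | leaf => exact hl.2
        | edge y r₁ r₂ => exact hang_right l y ⟨r₁, r₂⟩ hl.2 (hr.1 _ _ _ rfl)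
      refine ⟨?_, hang_left x ⟨l, r⟩ hp⟩
      rintro x' l' r' h
      cases h
      exact hp
  obtain ⟨l, r⟩ := t
  cases r with
  | leaf => exact (h1 l).2
  | edge y r₁ r₂ => exact hang_right l y ⟨r₁, r₂⟩ (h1 l).2 ((h1 _).1 y r₁ r₂ rfl)

end EdgeTree

/-- The linear extension of replacing the right child by a tree hanging from an edge. -/
def hangRight (K : Type*) [Field K] {γ : ℕ} (l : Child γ) (y : Fin γ) :
    TreeSpace K γ →ₗ[K] TreeSpace K γ :=
  Finsupp.lmapDomain K K fun u : EdgeTree γ => ⟨l, u.below y⟩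

/-- The linear extension of replacing the left child by a tree hanging from an edge. -/
def hangLeft (K : Type*) [Field K] {γ : ℕ} (r : Child γ) (x : Fin γ) :
    TreeSpace K γ →ₗ[K] TreeSpace K γ :=
  Finsupp.lmapDomain K K fun u : EdgeTree γ => ⟨u.below x, r⟩

/-- The basis vector of an edge valued tree. -/
abbrev treeVec (K : Type*) [Field K] {γ : ℕ} (t : EdgeTree γ) : TreeSpace K γ := single t 1

theorem hangRight_single (l : Child γ) (y : Fin γ) (t : EdgeTree γ) :
    hangRight K l y (treeVec K t) = treeVec K ⟨l, t.below y⟩ := by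
  simp [hangRight]

theorem hangLeft_single (r : Child γ) (x : Fin γ) (t : EdgeTree γ) :
    hangLeft K r x (treeVec K t) = treeVec K ⟨t.below x, r⟩ := by
  simp [hangLeft]

theorem linearMap_ext {M : Type*} [AddCommMonoid M] [Module K M] {f g : TreeSpace K γ →ₗ[K] M}
    (h : ∀ t, f (treeVec K t) = g (treeVec K t)) : f = g :=
  Finsupp.lhom_ext' fun t => LinearMap.ext_ring (h t)

-- The recursive rules for the products, extended bilinearly.

theorem treePrec_single (a : Fin γ) (t s : EdgeTree γ) :
    treePrec K a (treeVec K t) (treeVec K s) = precTree K a t s := by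
  simp [treePrec, bilinExt]

theorem treeSucc_single (a : Fin γ) (s t : EdgeTree γ) :
    treeSucc K a (treeVec K s) (treeVec K t) = succTree K a s t := by
  simp [treeSucc, bilinExt]

theorem treePrec_leaf (a : Fin γ) (l : Child γ) (u : TreeSpace K γ) :
    treePrec K a (treeVec K ⟨l, .leaf⟩) u = hangRight K l a u := by
  suffices treePrec K a (treeVec K ⟨l, .leaf⟩) = hangRight K l a by rw [this]
  refine linearMap_ext fun s => ?_
  rw [treePrec_single, precTree, hangRight_single]

theorem treeSucc_leaf (a : Fin γ) (r : Child γ) (u : TreeSpace K γ) :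
    treeSucc K a u (treeVec K ⟨.leaf, r⟩) = hangLeft K r a u := by
  suffices (treeSucc K a).flip (treeVec K ⟨.leaf, r⟩) = hangLeft K r a by
    rw [← LinearMap.flip_apply, this]
  refine linearMap_ext fun s => ?_
  rw [LinearMap.flip_apply, treeSucc_single, succTree, hangLeft_single]

theorem treePrec_hangRight (a : Fin γ) (l : Child γ) (y : Fin γ) (t u : TreeSpace K γ) :
    treePrec K a (hangRight K l y t) u =
      hangRight K l (min a y) (treePrec K a t u + treeSucc K y t u) := by
  suffices (treePrec K a).comp (hangRight K l y) =
      (treePrec K a + treeSucc K y).compr₂ (hangRight K l (min a y)) from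
    LinearMap.congr_fun₂ this t u
  refine linearMap_ext fun t => linearMap_ext fun s => ?_
  rw [LinearMap.comp_apply, hangRight_single, treePrec_single, LinearMap.compr₂_apply,
    LinearMap.add_apply, LinearMap.add_apply, treePrec_single, treeSucc_single]
  rw [EdgeTree.below, precTree]
  rfl

theorem treeSucc_hangLeft (a : Fin γ) (r : Child γ) (x : Fin γ) (u t : TreeSpace K γ) :
    treeSucc K a u (hangLeft K r x t) =
      hangLeft K r (min a x) (treeSucc K a u t + treePrec K x u t) := by
  suffices (treeSucc K a).compl₂ (hangLeft K r x) =
      (treeSucc K a + treePrec K x).compr₂ (hangLeft K r (min a x)) from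
    LinearMap.congr_fun₂ this u t
  refine linearMap_ext fun s => linearMap_ext fun t => ?_
  rw [LinearMap.compl₂_apply, hangLeft_single, treeSucc_single, LinearMap.compr₂_apply,
    LinearMap.add_apply, LinearMap.add_apply, treePrec_single, treeSucc_single]
  rw [EdgeTree.below, succTree]
  rfl

/-- The tree with given children, extended bilinearly. -/
def join (K : Type*) [Field K] (γ : ℕ) :
    (Child γ →₀ K) →ₗ[K] (Child γ →₀ K) →ₗ[K] TreeSpace K γ :=
  Finsupp.linearCombination K fun l => Finsupp.lmapDomain K K fun r => ⟨l, r⟩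

theorem join_single (l r : Child γ) : join K γ (single l 1) (single r 1) = treeVec K ⟨l, r⟩ := by
  simp [join]

theorem hangRight_eq_join (l : Child γ) (y : Fin γ) (u : TreeSpace K γ) :
    hangRight K l y u = join K γ (single l 1) (Finsupp.lmapDomain K K (EdgeTree.below y) u) := by
  suffices hangRight K l y = (join K γ (single l 1)).comp
    (Finsupp.lmapDomain K K (EdgeTree.below y)) from LinearMap.congr_fun this u
  refine linearMap_ext fun t => ?_
  rw [hangRight_single, LinearMap.comp_apply, Finsupp.lmapDomain_apply, Finsupp.mapDomain_single,
    join_single]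

theorem hangLeft_eq_join (r : Child γ) (x : Fin γ) (u : TreeSpace K γ) :
    hangLeft K r x u = join K γ (Finsupp.lmapDomain K K (EdgeTree.below x) u) (single r 1) := by
  suffices hangLeft K r x = ((join K γ).flip (single r 1)).comp
    (Finsupp.lmapDomain K K (EdgeTree.below x)) from LinearMap.congr_fun this u
  refine linearMap_ext fun t => ?_
  rw [hangLeft_single, LinearMap.comp_apply, Finsupp.lmapDomain_apply, Finsupp.mapDomain_single,
    LinearMap.flip_apply, join_single]

/-- The recursion for `≺` descends only into the right child, so the new right child `β` does not
depend on the left one. -/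
theorem exists_treePrec_join (d : Fin γ) (r : Child γ) (z : TreeSpace K γ) :
    ∃ β, ∀ α, treePrec K d (join K γ α (single r 1)) z = join K γ α β := by
  suffices ∃ β, ∀ l, treePrec K d (treeVec K ⟨l, r⟩) z = join K γ (single l 1) β by
    obtain ⟨β, h⟩ := this
    refine ⟨β, fun α => ?_⟩
    suffices ((treePrec K d).flip z).comp ((join K γ).flip (single r 1)) = (join K γ).flip β from
      LinearMap.congr_fun this α
    refine Finsupp.lhom_ext' fun l => LinearMap.ext_ring ?_
    simpa [join_single] using h l
  cases r with
  | leaf => exact ⟨_, fun l => by rw [treePrec_leaf, hangRight_eq_join]⟩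
  | edge y r₁ r₂ =>
    refine ⟨Finsupp.lmapDomain K K (EdgeTree.below (min d y))
      (treePrec K d (treeVec K ⟨r₁, r₂⟩) z + treeSucc K y (treeVec K ⟨r₁, r₂⟩) z), fun l => ?_⟩
    have h : treeVec K (⟨l, .edge y r₁ r₂⟩ : EdgeTree γ) = hangRight K l y (treeVec K ⟨r₁, r₂⟩) :=
      (hangRight_single l y ⟨r₁, r₂⟩).symm
    rw [h, treePrec_hangRight, hangRight_eq_join]

theorem exists_treeSucc_join (c : Fin γ) (l : Child γ) (x : TreeSpace K γ) :
    ∃ α, ∀ β, treeSucc K c x (join K γ (single l 1) β) = join K γ α β := by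
  suffices ∃ α, ∀ r, treeSucc K c x (treeVec K ⟨l, r⟩) = join K γ α (single r 1) by
    obtain ⟨α, h⟩ := this
    refine ⟨α, fun β => ?_⟩
    suffices (treeSucc K c x).comp (join K γ (single l 1)) = join K γ α from
      LinearMap.congr_fun this β
    refine Finsupp.lhom_ext' fun r => LinearMap.ext_ring ?_
    simpa [join_single] using h r
  cases l with
  | leaf => exact ⟨_, fun r => by rw [treeSucc_leaf, hangLeft_eq_join]⟩
  | edge e l₁ l₂ =>
    refine ⟨Finsupp.lmapDomain K K (EdgeTree.below (min c e))
      (treeSucc K c x (treeVec K ⟨l₁, l₂⟩) + treePrec K e x (treeVec K ⟨l₁, l₂⟩)), fun r => ?_⟩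
    have h : treeVec K (⟨.edge e l₁ l₂, r⟩ : EdgeTree γ) = hangLeft K r e (treeVec K ⟨l₁, l₂⟩) :=
      (hangLeft_single r e ⟨l₁, l₂⟩).symm
    rw [h, treeSucc_hangLeft, hangLeft_eq_join]

/-- Acting on the left child of a node commutes with acting on its right child. -/
theorem tree_succ_prec (c d : Fin γ) (x y z : TreeSpace K γ) :
    treePrec K d (treeSucc K c x y) z = treeSucc K c x (treePrec K d y z) := by
  suffices ((treePrec K d).flip z).comp (treeSucc K c x) =
      (treeSucc K c x).comp ((treePrec K d).flip z) from LinearMap.congr_fun this y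
  refine linearMap_ext fun t => ?_
  obtain ⟨l, r⟩ := t
  obtain ⟨α, hα⟩ := exists_treeSucc_join c l x
  obtain ⟨β, hβ⟩ := exists_treePrec_join d r z
  simp only [LinearMap.comp_apply, LinearMap.flip_apply]
  rw [← join_single, hα, hβ, hβ, hα]

/-- The two relations need a joint induction: expanding `≺` on a tree whose right child is an edge
also produces a `≻` on the subtree, and conversely. -/
theorem tree_prec_prec_succ_succ (n : ℕ) : ∀ x y z : EdgeTree γ, x.size + y.size + z.size = n →
    ∀ c d : Fin γ,
    treePrec K d (treePrec K c (treeVec K x) (treeVec K y)) (treeVec K z) =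
      treePrec K (min c d) (treeVec K x)
        (treePrec K d (treeVec K y) (treeVec K z) + treeSucc K c (treeVec K y) (treeVec K z)) ∧
    treeSucc K c (treeVec K x) (treeSucc K d (treeVec K y) (treeVec K z)) =
      treeSucc K (min c d) (treePrec K d (treeVec K x) (treeVec K y) +
        treeSucc K c (treeVec K x) (treeVec K y)) (treeVec K z) := by
  induction n using Nat.strong_induction_on with
  | _ n ih =>
  intro x y z hn c d
  constructor
  · obtain ⟨l, r⟩ := x
    cases r with
    | leaf =>
      rw [treePrec_leaf, treePrec_hangRight, treePrec_leaf, min_comm]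
    | edge e r₁ r₂ =>
      have hx : treeVec K (⟨l, .edge e r₁ r₂⟩ : EdgeTree γ) = hangRight K l e (treeVec K ⟨r₁, r₂⟩) :=
        (hangRight_single l e ⟨r₁, r₂⟩).symm
      have h := fun c d => ih _ (by simp only [← hn, EdgeTree.size, Child.size]; omega)
        ⟨r₁, r₂⟩ y z rfl c d
      rw [hx, treePrec_hangRight, treePrec_hangRight, treePrec_hangRight]
      simp only [map_add, LinearMap.add_apply] at h ⊢
      -- With `t` the right subtree of `x`, the four terms of the left side regroup as follows: the
      -- first relation treats `(t ≺_c y) ≺_d z`, the mixed one `(t ≻_e y) ≺_d z`, and the third one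
      -- the two terms in `≻_{min c e}`.
      have h2 := (h e c).2
      have h1 := (h c d).1
      have hm : min d (min c e) = min (min c d) e := by rw [← min_assoc, min_comm d c]
      rw [hm, h1, tree_succ_prec, h2, min_comm e c, map_add, map_add]
      abel
  · obtain ⟨l, r⟩ := z
    cases l with
    | leaf =>
      rw [treeSucc_leaf, treeSucc_hangLeft, treeSucc_leaf, add_comm]
    | edge e l₁ l₂ =>
      have hz : treeVec K (⟨.edge e l₁ l₂, r⟩ : EdgeTree γ) = hangLeft K r e (treeVec K ⟨l₁, l₂⟩) :=
        (hangLeft_single r e ⟨l₁, l₂⟩).symm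
      have h := fun c d => ih _ (by simp only [← hn, EdgeTree.size, Child.size]; omega)
        x y ⟨l₁, l₂⟩ rfl c d
      rw [hz, treeSucc_hangLeft, treeSucc_hangLeft, treeSucc_hangLeft]
      simp only [map_add, LinearMap.add_apply] at h ⊢
      have h2 := (h c d).2
      have h1 := (h d e).1
      have hm : min c (min d e) = min (min c d) e := (min_assoc _ _ _).symm
      rw [hm, h2, ← tree_succ_prec, h1, map_add, map_add]
      abel

theorem treeSpace_induction {p : TreeSpace K γ → Prop} (zero : p 0)
    (add : ∀ u v, p u → p v → p (u + v)) (smul : ∀ (c : K) u, p u → p (c • u))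
    (basis : ∀ t, p (treeVec K t)) (u : TreeSpace K γ) : p u := by
  induction u using Finsupp.induction_linear with
  | zero => exact zero
  | add u v hu hv => exact add u v hu hv
  | single t c =>
    have := smul c _ (basis t)
    rwa [treeVec, Finsupp.smul_single_one] at this

theorem tree_prec_prec (c d : Fin γ) (x y z : TreeSpace K γ) :
    treePrec K d (treePrec K c x y) z =
      treePrec K (min c d) x (treePrec K d y z) + treePrec K (min c d) x (treeSucc K c y z) := by
  induction x using treeSpace_induction with
  | zero => simp
  | add u v hu hv => simp only [map_add, LinearMap.add_apply, hu, hv]; abel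
  | smul k u hu => simp only [map_smul, LinearMap.smul_apply, hu, smul_add]
  | basis x =>
  induction y using treeSpace_induction with
  | zero => simp
  | add u v hu hv => simp only [map_add, LinearMap.add_apply, hu, hv]; abel
  | smul k u hu => simp only [map_smul, LinearMap.smul_apply, hu, smul_add]
  | basis y =>
  induction z using treeSpace_induction with
  | zero => simp
  | add u v hu hv => simp only [map_add, hu, hv]; abel
  | smul k u hu => simp only [map_smul, hu, smul_add]
  | basis z => rw [(tree_prec_prec_succ_succ _ x y z rfl c d).1, map_add]

theorem tree_succ_succ (c d : Fin γ) (x y z : TreeSpace K γ) :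
    treeSucc K c x (treeSucc K d y z) =
      treeSucc K (min c d) (treePrec K d x y) z + treeSucc K (min c d) (treeSucc K c x y) z := by
  induction x using treeSpace_induction with
  | zero => simp
  | add u v hu hv => simp only [map_add, LinearMap.add_apply, hu, hv]; abel
  | smul k u hu => simp only [map_smul, LinearMap.smul_apply, hu, smul_add]
  | basis x =>
  induction y using treeSpace_induction with
  | zero => simp
  | add u v hu hv => simp only [map_add, LinearMap.add_apply, hu, hv]; abel
  | smul k u hu => simp only [map_smul, LinearMap.smul_apply, hu, smul_add]
  | basis y =>
  induction z using treeSpace_induction with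
  | zero => simp
  | add u v hu hv => simp only [map_add, hu, hv]; abel
  | smul k u hu => simp only [map_smul, hu, smul_add]
  | basis z => rw [(tree_prec_prec_succ_succ _ x y z rfl c d).2, map_add, LinearMap.add_apply]

theorem tree_precSuccRel (K : Type*) [Field K] (γ : ℕ) :
    PrecSuccRel (treePrec K (γ := γ)) (treeSucc K) where
  prec_prec c d x y z := by rw [tree_prec_prec, map_add]
  succ_prec := tree_succ_prec
  succ_succ c d x y z := by rw [tree_succ_succ, map_add, LinearMap.add_apply]

/-! ### The universal property -/

namespace PrecSuccRel

variable (P S : Fin γ → A →ₗ[K] A →ₗ[K] A)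

/-- `u ≺_y v` if the child is an edge labeled `y`, and `u` if it is a leaf. -/
def precChild : Child γ → A → A →ₗ[K] A
  | .leaf, _ => LinearMap.id
  | .edge y _ _, v => (P y).flip v

/-- `v ≻_x u` if the child is an edge labeled `x`, and `u` if it is a leaf. -/
def succChild : Child γ → A → A →ₗ[K] A
  | .leaf, _ => LinearMap.id
  | .edge x _ _, v => S x v

/-- The value at `b` of the tree below an edge. -/
def childVal (b : A) : Child γ → A
  -- A dummy value: `precChild` and `succChild` ignore it at a leaf.
  | .leaf => 0
  | .edge _ l r => precChild P r (childVal b r) (succChild S l (childVal b l) b)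

/-- The value at `b` of an edge valued tree. -/
def treeVal (b : A) (t : EdgeTree γ) : A :=
  precChild P t.right (childVal P S b t.right) (succChild S t.left (childVal P S b t.left) b)

theorem treeVal_right (b : A) (l : Child γ) (y : Fin γ) (t : EdgeTree γ) :
    treeVal P S b ⟨l, t.below y⟩ = P y (treeVal P S b ⟨l, .leaf⟩) (treeVal P S b t) := rfl

/-- The linear extension of `treeVal`. -/
def lift (b : A) : TreeSpace K γ →ₗ[K] A := Finsupp.linearCombination K (treeVal P S b)

theorem lift_single (b : A) (t : EdgeTree γ) : lift P S b (treeVec K t) = treeVal P S b t := by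
  simp [lift]

variable {P S}

/-- In `treeVal` the left child acts first and the right child last; the mixed relation allows the
left action to be moved outside. -/
theorem treeVal_left (h : PrecSuccRel P S) (b : A) (r : Child γ) (x : Fin γ) (t : EdgeTree γ) :
    treeVal P S b ⟨t.below x, r⟩ = S x (treeVal P S b t) (treeVal P S b ⟨.leaf, r⟩) := by
  cases r with
  | leaf => rfl
  | edge y r₁ r₂ => exact h.succ_prec _ _ _ _ _

theorem lift_hangRight (b : A) (l : Child γ) (y : Fin γ) (u : TreeSpace K γ) :
    lift P S b (hangRight K l y u) = P y (treeVal P S b ⟨l, .leaf⟩) (lift P S b u) := by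
  suffices (lift P S b).comp (hangRight K l y) =
    (P y (treeVal P S b ⟨l, .leaf⟩)).comp (lift P S b) from LinearMap.congr_fun this u
  refine linearMap_ext fun t => ?_
  simp only [LinearMap.comp_apply]
  rw [hangRight_single, lift_single, lift_single, treeVal_right]

theorem lift_hangLeft (h : PrecSuccRel P S) (b : A) (r : Child γ) (x : Fin γ)
    (u : TreeSpace K γ) :
    lift P S b (hangLeft K r x u) = S x (lift P S b u) (treeVal P S b ⟨.leaf, r⟩) := by
  suffices (lift P S b).comp (hangLeft K r x) =
    ((S x).flip (treeVal P S b ⟨.leaf, r⟩)).comp (lift P S b) from LinearMap.congr_fun this u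
  refine linearMap_ext fun t => ?_
  simp only [LinearMap.comp_apply]
  rw [hangLeft_single, lift_single, lift_single, h.treeVal_left, LinearMap.flip_apply]

/-- The recursion for `s ≺_a t` is the relation for `(u ≺_e v) ≺_a w`, with `u` the part of `s`
without its right subtree and `v` that subtree. Thus the relation in the target closes the
induction; `≻` is symmetric. -/
theorem lift_tree (h : PrecSuccRel P S) (b : A) (n : ℕ) : ∀ s t : EdgeTree γ,
    s.size + t.size = n → ∀ a : Fin γ,
    lift P S b (treePrec K a (treeVec K s) (treeVec K t)) =
      P a (treeVal P S b s) (treeVal P S b t) ∧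
    lift P S b (treeSucc K a (treeVec K s) (treeVec K t)) =
      S a (treeVal P S b s) (treeVal P S b t) := by
  induction n using Nat.strong_induction_on with
  | _ n ih =>
  intro s t hn a
  constructor
  · obtain ⟨l, r⟩ := s
    cases r with
    | leaf => rw [treePrec_leaf, lift_hangRight, lift_single]
    | edge e r₁ r₂ =>
      have hx : treeVec K (⟨l, .edge e r₁ r₂⟩ : EdgeTree γ) = hangRight K l e (treeVec K ⟨r₁, r₂⟩) :=
        (hangRight_single l e ⟨r₁, r₂⟩).symm
      have ih' := ih _ (by simp only [← hn, EdgeTree.size, Child.size]; omega) ⟨r₁, r₂⟩ t rfl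
      have hv : treeVal P S b ⟨l, .edge e r₁ r₂⟩ = _ := treeVal_right P S b l e ⟨r₁, r₂⟩
      rw [hx, treePrec_hangRight, lift_hangRight, map_add, (ih' a).1, (ih' e).2, hv, h.prec_prec,
        min_comm]
  · obtain ⟨l, r⟩ := t
    cases l with
    | leaf => rw [treeSucc_leaf, h.lift_hangLeft, lift_single]
    | edge e l₁ l₂ =>
      have hx : treeVec K (⟨.edge e l₁ l₂, r⟩ : EdgeTree γ) = hangLeft K r e (treeVec K ⟨l₁, l₂⟩) :=
        (hangLeft_single r e ⟨l₁, l₂⟩).symm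
      have ih' := ih _ (by simp only [← hn, EdgeTree.size, Child.size]; omega) s ⟨l₁, l₂⟩ rfl
      have hv : treeVal P S b ⟨.edge e l₁ l₂, r⟩ = _ := h.treeVal_left b r e ⟨l₁, l₂⟩
      rw [hx, treeSucc_hangLeft, h.lift_hangLeft, map_add, (ih' a).2, (ih' e).1, hv, h.succ_succ,
        add_comm]

theorem lift_treePrec (h : PrecSuccRel P S) (b : A) (a : Fin γ) (u v : TreeSpace K γ) :
    lift P S b (treePrec K a u v) = P a (lift P S b u) (lift P S b v) := by
  suffices (treePrec K a).compr₂ (lift P S b) = (P a).compl₁₂ (lift P S b) (lift P S b) from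
    LinearMap.congr_fun₂ this u v
  refine linearMap_ext fun s => linearMap_ext fun t => ?_
  rw [LinearMap.compr₂_apply, LinearMap.compl₁₂_apply, lift_single, lift_single]
  exact (h.lift_tree b _ s t rfl a).1

theorem lift_treeSucc (h : PrecSuccRel P S) (b : A) (a : Fin γ) (u v : TreeSpace K γ) :
    lift P S b (treeSucc K a u v) = S a (lift P S b u) (lift P S b v) := by
  suffices (treeSucc K a).compr₂ (lift P S b) = (S a).compl₁₂ (lift P S b) (lift P S b) from
    LinearMap.congr_fun₂ this u v
  refine linearMap_ext fun s => linearMap_ext fun t => ?_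
  rw [LinearMap.compr₂_apply, LinearMap.compl₁₂_apply, lift_single, lift_single]
  exact (h.lift_tree b _ s t rfl a).2

end PrecSuccRel

theorem existsUnique_isHom {S : Algebra K γ (TreeSpace K γ)} (hP : S.prec = treePrec K)
    (hS : S.succ = treeSucc K) (T : Algebra K γ A) (b : A) :
    ∃! φ : TreeSpace K γ →ₗ[K] A, S.IsHom T φ ∧ φ (treeVec K (EdgeTree.one γ)) = b := by
  refine ⟨PrecSuccRel.lift T.prec T.succ b, ⟨Algebra.IsHom.of_prec_succ ?_ ?_, ?_⟩, ?_⟩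
  · rw [hP]
    exact T.precSuccRel.lift_treePrec b
  · rw [hS]
    exact T.precSuccRel.lift_treeSucc b
  · rw [PrecSuccRel.lift_single]
    rfl
  · rintro ψ ⟨hψ, hb⟩
    have hp := hψ.map_prec
    have hs := hψ.map_succ
    rw [hP] at hp
    rw [hS] at hs
    refine linearMap_ext fun t => ?_
    induction t using EdgeTree.hang_induction with
    | one =>
      rw [hb, PrecSuccRel.lift_single]
      rfl
    | hang_left x t ht =>
      -- Hanging `t` to the left of `•` is the product `t ≻_x •`, which any morphism must respect.
      rw [← hangLeft_single, ← treeSucc_leaf, hs, T.precSuccRel.lift_treeSucc, ht]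
      congr 1
      exact hb.trans (by rw [PrecSuccRel.lift_single]; rfl)
    | hang_right l y t hl ht =>
      rw [← hangRight_single, ← treePrec_leaf, hp, T.precSuccRel.lift_treePrec, ht, hl]

/-! ### Evaluation of grafted trees -/

namespace SynTree

variable {G : Type}

theorem arity_graft (t s : SynTree G) {i : ℕ} (hi : i < t.arity) :
    (t.graft i s).arity + 1 = t.arity + s.arity := by
  induction t generalizing i with
  | leaf =>
    have : i = 0 := by simpa [arity] using hi
    simp [graft, arity, this, add_comm]
  | node g l r hl hr =>
    simp only [arity] at hi
    by_cases h : i < l.arity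
    · have := hl h
      simp only [graft, h, if_true, arity]
      omega
    · have := hr (i := i - l.arity) (by omega)
      simp only [graft, h, if_false, arity]
      omega

theorem evalAt_congr {A : Type*} (op : G → A → A → A) (t : SynTree G) {e e' : ℕ → A}
    (h : ∀ j < t.arity, e j = e' j) : t.evalAt op e = t.evalAt op e' := by
  induction t generalizing e e' with
  | leaf => exact h 0 (by simp [arity])
  | node g l r hl hr =>
    simp only [arity] at h
    simp only [evalAt]
    rw [hl fun j hj => h j (by omega), hr fun j hj => h _ (by omega)]

/-- The inputs of a tree on whose leaf at position `i` a tree with `m` leaves and value `v` is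
grafted. -/
def graftInput {A : Type*} (i m : ℕ) (v : A) (e : ℕ → A) : ℕ → A :=
  Function.update (fun j => if j < i then e j else e (j + m - 1)) i v

theorem evalAt_graft {A : Type*} (op : G → A → A → A) (t s : SynTree G) {i : ℕ}
    (hi : i < t.arity) (e : ℕ → A) :
    (t.graft i s).evalAt op e =
      t.evalAt op (graftInput i s.arity (s.evalAt op fun k => e (k + i)) e) := by
  induction t generalizing i e with
  | leaf =>
    have : i = 0 := by simpa [arity] using hi
    simp [graft, evalAt, this, graftInput]
  | node g l r hl hr =>
    simp only [arity] at hi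
    have hs := s.arity_pos
    by_cases h : i < l.arity
    · have ha := arity_graft l s h
      simp only [graft, h, if_true, evalAt]
      rw [hl h]
      congr 2
      funext j
      rw [graftInput, Function.update_of_ne (by omega), if_neg (by omega)]
      congr 1
      omega
    · simp only [graft, h, if_false, evalAt]
      rw [hr (by omega)]
      congr 1
      · refine evalAt_congr op l fun j hj => ?_
        rw [graftInput, Function.update_of_ne (by omega), if_pos (by omega)]
      · congr 1
        funext j
        obtain rfl | hj := eq_or_ne j (i - l.arity)
        · have h2 : i - l.arity + l.arity = i := by omega
          rw [graftInput, graftInput, Function.update_self, h2, Function.update_self]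
          congr 1
          funext k
          congr 1
          omega
        · rw [graftInput, graftInput, Function.update_of_ne hj, Function.update_of_ne (by omega)]
          by_cases h3 : j < i - l.arity
          · rw [if_pos h3, if_pos (by omega)]
          · rw [if_neg h3, if_neg (by omega)]
            congr 1
            omega

/-- Multilinearity of the operation of a tree: each leaf occurs exactly once. -/
theorem exists_evalAt_update (op : G → A →ₗ[K] A →ₗ[K] A) (t : SynTree G) {i : ℕ}
    (hi : i < t.arity) (e : ℕ → A) :
    ∃ Λ : A →ₗ[K] A, ∀ v,
      t.evalAt (fun g x y => op g x y) (Function.update e i v) = Λ v := by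
  induction t generalizing i e with
  | leaf =>
    have : i = 0 := by simpa [arity] using hi
    exact ⟨LinearMap.id, fun v => by simp [evalAt, this]⟩
  | node g l r hl hr =>
    simp only [arity] at hi
    by_cases h : i < l.arity
    · obtain ⟨Λ, hΛ⟩ := hl h e
      refine ⟨((op g).flip (r.evalAt (fun g x y => op g x y) fun j => e (j + l.arity))).comp Λ,
        fun v => ?_⟩
      simp only [evalAt, hΛ, LinearMap.comp_apply, LinearMap.flip_apply]
      congr 2
      funext j
      rw [Function.update_of_ne (by omega)]
    · obtain ⟨Λ, hΛ⟩ := hr (i := i - l.arity) (by omega) fun j => e (j + l.arity)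
      refine ⟨(op g (l.evalAt (fun g x y => op g x y) e)).comp Λ, fun v => ?_⟩
      simp only [evalAt, LinearMap.comp_apply, ← hΛ]
      congr 1
      · congr 1
        refine evalAt_congr _ l fun j hj => ?_
        rw [Function.update_of_ne (by omega)]
      · congr 1
        funext j
        obtain rfl | hj := eq_or_ne j (i - l.arity)
        · have h2 : i - l.arity + l.arity = i := by omega
          rw [Function.update_self, h2, Function.update_self]
        · rw [Function.update_of_ne hj, Function.update_of_ne (by omega)]

end SynTree

variable {G : Type}

-- Partial compositions acting on an algebra.

theorem act_single (op : G → A →ₗ[K] A →ₗ[K] A) (e : ℕ → A) (t : SynTree G) :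
    act op e (single t 1) = t.evalAt (fun g x y => op g x y) e := by
  simp [act]

theorem act_mapDomain (op : G → A →ₗ[K] A →ₗ[K] A) (e : ℕ → A) (f : SynTree G → SynTree G)
    (x : FreeOperad K G) :
    act op e (Finsupp.mapDomain f x) =
      x.sum fun t c => c • (f t).evalAt (fun g x y => op g x y) e := by
  rw [act, Finsupp.linearCombination_mapDomain, Finsupp.linearCombination_apply]
  rfl

theorem arity_of_mem_support {x : FreeOperad K G} {n : ℕ} (hx : x ∈ freeComponent K G n)
    {t : SynTree G} (ht : t ∈ x.support) : t.arity = n :=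
  hx ht

theorem act_graft_tree (op : G → A →ₗ[K] A →ₗ[K] A) (e : ℕ → A) {x : FreeOperad K G} {n i : ℕ}
    (hx : x ∈ freeComponent K G n) (hi : i < n) (s : SynTree G) :
    act op e (Finsupp.mapDomain (fun t : SynTree G => t.graft i s) x) =
      act op (graftInput i s.arity (s.evalAt (fun g x y => op g x y) fun k => e (k + i)) e) x := by
  rw [act_mapDomain, act, Finsupp.linearCombination_apply]
  refine Finsupp.sum_congr fun t ht => ?_
  rw [evalAt_graft _ _ _ (by rwa [arity_of_mem_support hx ht])]

theorem exists_act_update (op : G → A →ₗ[K] A →ₗ[K] A) (e : ℕ → A) {x : FreeOperad K G}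
    {n i : ℕ} (hx : x ∈ freeComponent K G n) (hi : i < n) :
    ∃ Λ : A →ₗ[K] A, ∀ v, act op (Function.update e i v) x = Λ v := by
  have h : ∀ t : SynTree G, ∃ Λ : A →ₗ[K] A, t.arity = n → ∀ v,
      t.evalAt (fun g x y => op g x y) (Function.update e i v) = Λ v := by
    intro t
    by_cases ht : t.arity = n
    · obtain ⟨Λ, hΛ⟩ := exists_evalAt_update op t (i := i) (by omega) e
      exact ⟨Λ, fun _ => hΛ⟩
    · exact ⟨0, fun h => absurd h ht⟩
  choose Λ hΛ using h
  refine ⟨x.sum fun t c => c • Λ t, fun v => ?_⟩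
  rw [act, Finsupp.linearCombination_apply, Finsupp.sum, Finsupp.sum, LinearMap.sum_apply]
  refine Finset.sum_congr rfl fun t ht => ?_
  rw [hΛ t (arity_of_mem_support hx ht), LinearMap.smul_apply]

/-- The inputs to the right of the grafted tree are shifted by its arity, so one map `Λ` serves all
`x` of a fixed arity `n` only. -/
theorem exists_act_tree_graft (op : G → A →ₗ[K] A →ₗ[K] A) (e : ℕ → A) (s : SynTree G)
    {i : ℕ} (hi : i < s.arity) (n : ℕ) :
    ∃ Λ : A →ₗ[K] A, ∀ x ∈ freeComponent K G n,
      act op e (Finsupp.mapDomain (fun t : SynTree G => s.graft i t) x) =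
        Λ (act op (fun k => e (k + i)) x) := by
  obtain ⟨Λ, hΛ⟩ := exists_evalAt_update op s hi fun j => if j < i then e j else e (j + n - 1)
  refine ⟨Λ, fun x hx => ?_⟩
  rw [act_mapDomain, act, Finsupp.linearCombination_apply, Finsupp.sum, Finsupp.sum, map_sum]
  refine Finset.sum_congr rfl fun t ht => ?_
  rw [evalAt_graft _ _ _ hi, graftInput, arity_of_mem_support hx ht, hΛ, map_smul]

theorem map_act {B : Type*} [AddCommGroup B] [Module K B] {op : G → A →ₗ[K] A →ₗ[K] A}
    {op' : G → B →ₗ[K] B →ₗ[K] B} {φ : A →ₗ[K] B}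
    (h : ∀ g x y, φ (op g x y) = op' g (φ x) (φ y)) (e : ℕ → A) (x : FreeOperad K G) :
    φ (act op e x) = act op' (fun i => φ (e i)) x := by
  have key : ∀ (t : SynTree G) (e : ℕ → A), φ (t.evalAt (fun g x y => op g x y) e) =
      t.evalAt (fun g x y => op' g x y) fun i => φ (e i) := by
    intro t
    induction t with
    | leaf => exact fun _ => rfl
    | node g l r hl hr =>
      intro e
      simp only [evalAt, h, hl, hr]
  suffices φ.comp (act op e) = act op' (fun i => φ (e i)) from LinearMap.congr_fun this x
  refine Finsupp.lhom_ext' fun t => LinearMap.ext_ring ?_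
  simp only [LinearMap.comp_apply, Finsupp.lsingle_apply, act_single, key]

/-! ### Homogeneous components of the free operad -/

theorem filter_mem_freeComponent (x : FreeOperad K G) (n : ℕ) :
    x.filter (fun t => t.arity = n) ∈ freeComponent K G n := by
  rw [freeComponent, Finsupp.mem_supported]
  intro t ht
  rw [Finset.mem_coe, Finsupp.support_filter] at ht
  exact (Finset.mem_filter.1 ht).2

theorem filter_of_mem {x : FreeOperad K G} {n : ℕ} (hx : x ∈ freeComponent K G n) (m : ℕ) :
    x.filter (fun t => t.arity = m) = if m = n then x else 0 := by
  split_ifs with h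
  · subst h
    rw [Finsupp.filter_eq_self_iff]
    intro t ht
    exact arity_of_mem_support hx (Finsupp.mem_support_iff.2 ht)
  · rw [Finsupp.filter_eq_zero_iff]
    intro t ht
    by_contra h0
    exact h (ht.symm.trans (arity_of_mem_support hx (Finsupp.mem_support_iff.2 h0)))

theorem eq_sum_filter (x : FreeOperad K G) :
    x = ∑ n ∈ x.support.image arity, x.filter (fun t => t.arity = n) := by
  ext t
  simp only [Finsupp.finsetSum_apply, Finsupp.filter_apply, Finset.sum_ite_eq]
  split_ifs with h
  · rfl
  · by_contra h0
    exact h (Finset.mem_image_of_mem _ (Finsupp.mem_support_iff.2 h0))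

theorem mapDomain_mem_freeComponent {x : FreeOperad K G} {m n : ℕ}
    (hx : x ∈ freeComponent K G m) {f : SynTree G → SynTree G}
    (hf : ∀ t : SynTree G, t.arity = m → (f t).arity = n) :
    Finsupp.mapDomain f x ∈ freeComponent K G n := by
  classical
  rw [freeComponent, Finsupp.mem_supported]
  intro t ht
  obtain ⟨s, hs, rfl⟩ := Finset.mem_image.1 (Finsupp.mapDomain_support ht)
  exact hf s (arity_of_mem_support hx hs)

/-! ### The operad ideal of identities of an algebra -/

/-- The operations that vanish identically in an algebra. -/
def identities (op : G → A →ₗ[K] A →ₗ[K] A) : Submodule K (FreeOperad K G) where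
  carrier := {x | ∀ n e, act op e (x.filter fun t => t.arity = n) = 0}
  add_mem' hx hy n e := by rw [Finsupp.filter_add, map_add, hx n e, hy n e, add_zero]
  zero_mem' n e := by rw [Finsupp.filter_zero, map_zero]
  smul_mem' c x hx n e := by rw [Finsupp.filter_smul, map_smul, hx n e, smul_zero]

theorem mem_identities_iff (op : G → A →ₗ[K] A →ₗ[K] A) {x : FreeOperad K G} {n : ℕ}
    (hx : x ∈ freeComponent K G n) : x ∈ identities op ↔ ∀ e, act op e x = 0 := by
  constructor
  · intro h e
    have := h n e
    rwa [filter_of_mem hx, if_pos rfl] at this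
  · intro h m e
    rw [filter_of_mem hx]
    split_ifs
    · exact h e
    · exact map_zero _

theorem filter_mem_identities {op : G → A →ₗ[K] A →ₗ[K] A} {x : FreeOperad K G}
    (hx : x ∈ identities op) (n : ℕ) : x.filter (fun t => t.arity = n) ∈ identities op :=
  (mem_identities_iff op (filter_mem_freeComponent x n)).2 (hx n)

/-- Grafting a tree on an identity only specialises one of its inputs; grafting an identity on a
tree applies a linear map to zero. -/
theorem isOperadIdeal_identities (op : G → A →ₗ[K] A →ₗ[K] A) :
    IsOperadIdeal (identities op) where
  graded _ hx n := filter_mem_identities hx n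
  comp_tree n x hx hn i hi s := by
    have hc := mapDomain_mem_freeComponent (f := fun t : SynTree G => t.graft i s)
      (n := n + s.arity - 1) hn fun t ht => by
        have := arity_graft t s (i := i) (by omega)
        omega
    rw [mem_identities_iff op hc]
    intro e
    rw [act_graft_tree op e hn hi]
    exact (mem_identities_iff op hn).1 hx _
  tree_comp x hx s i hi := by
    rw [eq_sum_filter x, ← Finsupp.lmapDomain_apply K K, map_sum]
    refine Submodule.sum_mem _ fun n _ => ?_
    have hn := filter_mem_freeComponent x n
    have hc := mapDomain_mem_freeComponent (f := fun t : SynTree G => s.graft i t)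
      (n := s.arity + n - 1) hn fun t ht => by
        have := arity_graft s t hi
        omega
    rw [Finsupp.lmapDomain_apply, mem_identities_iff op hc]
    intro e
    obtain ⟨Λ, hΛ⟩ := exists_act_tree_graft op e s hi n
    rw [hΛ _ hn, hx n, map_zero]

theorem identities_le_ker (op : G → A →ₗ[K] A →ₗ[K] A) (e : ℕ → A) :
    identities op ≤ LinearMap.ker (act op e) := by
  intro x hx
  rw [LinearMap.mem_ker, eq_sum_filter x, map_sum]
  exact Finset.sum_eq_zero fun n _ => hx n e

theorem Algebra.operadIdeal_le_ker (S : Algebra K γ A) (e : ℕ → A) :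
    operadIdeal (dendrRel K γ) ≤ LinearMap.ker (act S.op e) := by
  refine le_trans (sInf_le ?_) (identities_le_ker S.op e)
  exact ⟨isOperadIdeal_identities S.op, fun r hr =>
    (mem_identities_iff S.op hr.1).2 fun e => S.rel r hr e⟩

/-! ### The quotient of the free operad by an ideal -/

theorem isOperadIdeal_operadIdeal (R : Submodule K (FreeOperad K G)) :
    IsOperadIdeal (operadIdeal R) where
  graded x hx n := by
    simp only [operadIdeal, Submodule.mem_sInf] at hx ⊢
    exact fun I hI => hI.1.graded x (hx I hI) n
  comp_tree n x hx hn i hi s := by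
    simp only [operadIdeal, Submodule.mem_sInf] at hx ⊢
    exact fun I hI => hI.1.comp_tree n x (hx I hI) hn i hi s
  tree_comp x hx s i hi := by
    simp only [operadIdeal, Submodule.mem_sInf] at hx ⊢
    exact fun I hI => hI.1.tree_comp x (hx I hI) s i hi

theorem le_operadIdeal (R : Submodule K (FreeOperad K G)) : R ≤ operadIdeal R :=
  le_sInf fun _ hI => hI.2

/-- Joining two trees by a root, extended bilinearly. -/
def freeOp (K : Type*) [Field K] {G : Type} (g : G) :
    FreeOperad K G →ₗ[K] FreeOperad K G →ₗ[K] FreeOperad K G :=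
  Finsupp.linearCombination K fun l => Finsupp.lmapDomain K K fun r => .node g l r

theorem freeOp_single (g : G) (l r : SynTree G) :
    freeOp K g (single l 1) (single r 1) = single (.node g l r) 1 := by
  simp [freeOp]

/-- Writes the joining of trees as a partial composition, so that operad ideals are stable under
`freeOp`. -/
theorem freeOp_single_right (g : G) (x : FreeOperad K G) (s : SynTree G) :
    freeOp K g x (single s 1) =
      Finsupp.mapDomain (fun t => (SynTree.node g .leaf s).graft 0 t) x := by
  suffices (freeOp K g).flip (single s 1) = Finsupp.lmapDomain K K
    (fun t => (SynTree.node g .leaf s).graft 0 t) from LinearMap.congr_fun this x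
  refine Finsupp.lhom_ext' fun t => LinearMap.ext_ring ?_
  simp [freeOp_single, graft, arity]

theorem freeOp_single_left (g : G) (x : FreeOperad K G) (s : SynTree G) :
    freeOp K g (single s 1) x =
      Finsupp.mapDomain (fun t => (SynTree.node g s .leaf).graft s.arity t) x := by
  suffices freeOp K g (single s 1) = Finsupp.lmapDomain K K
    (fun t => (SynTree.node g s .leaf).graft s.arity t) from LinearMap.congr_fun this x
  refine Finsupp.lhom_ext' fun t => LinearMap.ext_ring ?_
  simp [freeOp_single, graft]

theorem mem_of_single_mem {M : Type*} [AddCommGroup M] [Module K M] (Λ : FreeOperad K G →ₗ[K] M)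
    (I : Submodule K M) (h : ∀ t, Λ (single t 1) ∈ I) (x : FreeOperad K G) : Λ x ∈ I := by
  induction x using Finsupp.induction_linear with
  | zero => simp
  | add u v hu hv => rw [map_add]; exact I.add_mem hu hv
  | single t c =>
    rw [← Finsupp.smul_single_one, map_smul]
    exact I.smul_mem c (h t)

namespace IsOperadIdeal

variable {I : Submodule K (FreeOperad K G)}

theorem freeOp_mem_left (hI : IsOperadIdeal I) (g : G) {x : FreeOperad K G} (hx : x ∈ I) (y : FreeOperad K G) :
    freeOp K g x y ∈ I := by
  refine mem_of_single_mem (freeOp K g x) I (fun s => ?_) y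
  rw [freeOp_single_right]
  exact hI.tree_comp x hx _ 0 (arity_pos _)

theorem freeOp_mem_right (hI : IsOperadIdeal I) (g : G) (x : FreeOperad K G) {y : FreeOperad K G} (hy : y ∈ I) :
    freeOp K g x y ∈ I := by
  refine mem_of_single_mem ((freeOp K g).flip y) I (fun s => ?_) x
  rw [LinearMap.flip_apply, freeOp_single_left]
  exact hI.tree_comp y hy _ _ (by simp [arity])

theorem exists_quotient_op (hI : IsOperadIdeal I) (g : G) :
    ∃ op : (FreeOperad K G ⧸ I) →ₗ[K] (FreeOperad K G ⧸ I) →ₗ[K] (FreeOperad K G ⧸ I),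
      ∀ x y, I.mkQ (freeOp K g x y) = op (I.mkQ x) (I.mkQ y) := by
  let f : FreeOperad K G →ₗ[K] FreeOperad K G →ₗ[K] (FreeOperad K G ⧸ I) :=
    (freeOp K g).compr₂ I.mkQ
  have hf : I ≤ LinearMap.ker f := by
    intro x hx
    rw [LinearMap.mem_ker]
    refine LinearMap.ext fun y => ?_
    exact (Submodule.Quotient.mk_eq_zero I).2 (hI.freeOp_mem_left g hx y)
  -- The operation descends to the quotient one argument at a time.
  have hf' : I ≤ LinearMap.ker (I.liftQ f hf).flip := by
    intro y hy
    rw [LinearMap.mem_ker]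
    refine LinearMap.ext fun x => ?_
    obtain ⟨x, rfl⟩ := I.mkQ_surjective x
    exact (Submodule.Quotient.mk_eq_zero I).2 (hI.freeOp_mem_right g x hy)
  exact ⟨(I.liftQ _ hf').flip, fun x y => rfl⟩

end IsOperadIdeal

theorem act_freeOp_leaf (x : FreeOperad K G) :
    act (freeOp K) (fun _ => single .leaf 1) x = x := by
  suffices act (freeOp K) (fun _ => single (SynTree.leaf : SynTree G) 1) = LinearMap.id from
    LinearMap.congr_fun this x
  refine Finsupp.lhom_ext' fun t => LinearMap.ext_ring ?_
  simp only [LinearMap.comp_apply, Finsupp.lsingle_apply, act_single, LinearMap.id_apply]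
  induction t with
  | leaf => rfl
  | node g l r hl hr => simp only [evalAt, hl, hr, freeOp_single]

/-- The grafts are done from right to left, so the positions of the leaves still to be filled do not
move. -/
theorem act_freeOp_single {x : FreeOperad K G} (hx : x ∈ freeComponent K G 3)
    {e : ℕ → FreeOperad K G} {s₀ s₁ s₂ : SynTree G} (h₀ : e 0 = single s₀ 1)
    (h₁ : e 1 = single s₁ 1) (h₂ : e 2 = single s₂ 1) :
    act (freeOp K) e x = Finsupp.mapDomain (fun t : SynTree G => t.graft 0 s₀)
      (Finsupp.mapDomain (fun t : SynTree G => t.graft 1 s₁)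
        (Finsupp.mapDomain (fun t : SynTree G => t.graft 2 s₂) x)) := by
  rw [← Finsupp.mapDomain_comp, ← Finsupp.mapDomain_comp, act, Finsupp.linearCombination_apply,
    Finsupp.mapDomain]
  refine Finsupp.sum_congr fun t ht => ?_
  rw [← Finsupp.smul_single_one]
  congr 1
  obtain ⟨g, g', rfl⟩ | ⟨g, g', rfl⟩ := eq_comb_of_arity (arity_of_mem_support hx ht)
  · simp [leftComb, evalAt, arity, graft, h₀, h₁, h₂, freeOp_single]
  · simp [rightComb, evalAt, arity, graft, h₀, h₁, h₂, freeOp_single]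

theorem IsOperadIdeal.act_freeOp_mem {I : Submodule K (FreeOperad K G)} (hI : IsOperadIdeal I)
    {x : FreeOperad K G} (hx : x ∈ I) (hx3 : x ∈ freeComponent K G 3) (e : ℕ → FreeOperad K G) :
    act (freeOp K) e x ∈ I := by
  -- By linearity in each input separately, it is enough to treat inputs that are trees, where
  -- stability under grafting applies.
  have step : ∀ i < 3, ∀ e : ℕ → FreeOperad K G,
      (∀ t, act (freeOp K) (Function.update e i (single t 1)) x ∈ I) →
        act (freeOp K) e x ∈ I := by
    intro i hi e h
    obtain ⟨Λ, hΛ⟩ := exists_act_update (freeOp K) e hx3 hi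
    have := mem_of_single_mem Λ I (fun t => hΛ _ ▸ h t) (e i)
    rwa [← hΛ, Function.update_eq_self] at this
  refine step 0 (by omega) _ fun s₀ => step 1 (by omega) _ fun s₁ => step 2 (by omega) _ fun s₂ => ?_
  rw [act_freeOp_single (s₀ := s₀) (s₁ := s₁) (s₂ := s₂) hx3 (by simp) (by simp) (by simp)]
  have h2 := mapDomain_mem_freeComponent (f := fun t : SynTree G => t.graft 2 s₂)
    (n := 2 + s₂.arity) hx3 fun t ht => by
      have := arity_graft t s₂ (i := 2) (by omega)
      omega
  have h1 := mapDomain_mem_freeComponent (f := fun t : SynTree G => t.graft 1 s₁)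
    (n := 1 + s₂.arity + s₁.arity) h2 fun t ht => by
      have := arity_graft t s₁ (i := 1) (by omega)
      omega
  exact hI.comp_tree _ _ (hI.comp_tree _ _ (hI.comp_tree _ _ hx hx3 2 (by omega) _) h2 1
    (by omega) _) h1 0 (by omega) _

theorem exists_quotient_algebra {I : Submodule K (FreeOperad K (Gen γ))} (hI : IsOperadIdeal I)
    (hR : dendrRel K γ ≤ I) :
    ∃ T : Algebra K γ (FreeOperad K (Gen γ) ⧸ I),
      ∀ g x y, I.mkQ (freeOp K g x y) = T.op g (I.mkQ x) (I.mkQ y) := by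
  choose op hop using hI.exists_quotient_op
  refine ⟨⟨op, fun r hr e => ?_⟩, hop⟩
  choose e' he' using fun i => I.mkQ_surjective (e i)
  have h := map_act hop e' r
  simp only [he'] at h
  rw [← h]
  exact (Submodule.Quotient.mk_eq_zero I).2 (hI.act_freeOp_mem (hR hr) hr.1 e')

/-- Let `φ` be the morphism to the quotient algebra sending `•` to the class of the one-leaf tree.
It maps `x(•, …, •)` to the value of `x` at that class, which is the class of `x` by
`act_freeOp_leaf`. -/
theorem ker_act_eq {S : Algebra K γ (TreeSpace K γ)} (hP : S.prec = treePrec K)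
    (hS : S.succ = treeSucc K) :
    LinearMap.ker (act S.op fun _ => treeVec K (EdgeTree.one γ)) = operadIdeal (dendrRel K γ) := by
  refine le_antisymm (fun x hx => ?_) (S.operadIdeal_le_ker _)
  obtain ⟨T, hT⟩ := exists_quotient_algebra (isOperadIdeal_operadIdeal _)
    (le_operadIdeal (dendrRel K γ))
  obtain ⟨φ, ⟨hφ, hφ1⟩, -⟩ := existsUnique_isHom hP hS T (Submodule.mkQ _ (single .leaf 1))
  have h1 := map_act hφ (fun _ => treeVec K (EdgeTree.one γ)) x
  have h2 := map_act hT (fun _ => single .leaf 1) x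
  rw [LinearMap.mem_ker.1 hx, map_zero] at h1
  simp only [hφ1] at h1
  rw [act_freeOp_leaf, ← h1] at h2
  exact (Submodule.Quotient.mk_eq_zero _).1 h2

/-! ### The grading -/

/-- The span of the edge valued trees with `n` internal nodes. -/
abbrev treeComponent (K : Type*) [Field K] (γ n : ℕ) : Submodule K (TreeSpace K γ) :=
  Finsupp.supported K K {t : EdgeTree γ | t.size = n}

theorem treeVec_mem (t : EdgeTree γ) : treeVec K t ∈ treeComponent K γ t.size :=
  Finsupp.single_mem_supported K 1 rfl

theorem map_mem_of_treeVec_mem {M : Type*} [AddCommGroup M] [Module K M]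
    (f : TreeSpace K γ →ₗ[K] M) {n : ℕ} {N : Submodule K M}
    (h : ∀ t : EdgeTree γ, t.size = n → f (treeVec K t) ∈ N) {u : TreeSpace K γ}
    (hu : u ∈ treeComponent K γ n) : f u ∈ N := by
  rw [treeComponent, Finsupp.supported_eq_span_single] at hu
  suffices Submodule.span K ((fun i => single i 1) '' {t : EdgeTree γ | t.size = n}) ≤ N.comap f
    from this hu
  rw [Submodule.span_le]
  rintro _ ⟨t, ht, rfl⟩
  exact h t ht

theorem hangRight_mem (l : Child γ) (y : Fin γ) {n : ℕ} {u : TreeSpace K γ}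
    (hu : u ∈ treeComponent K γ n) : hangRight K l y u ∈ treeComponent K γ (l.size + n + 1) := by
  refine map_mem_of_treeVec_mem _ (fun t ht => ?_) hu
  rw [hangRight_single, ← ht]
  exact treeVec_mem _

theorem hangLeft_mem (r : Child γ) (x : Fin γ) {n : ℕ} {u : TreeSpace K γ}
    (hu : u ∈ treeComponent K γ n) : hangLeft K r x u ∈ treeComponent K γ (n + r.size + 1) := by
  refine map_mem_of_treeVec_mem _ (fun t ht => ?_) hu
  rw [hangLeft_single, ← ht]
  exact treeVec_mem _

theorem tree_products_mem (n : ℕ) : ∀ s t : EdgeTree γ, s.size + t.size = n → ∀ a : Fin γ,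
    treePrec K a (treeVec K s) (treeVec K t) ∈ treeComponent K γ n ∧
    treeSucc K a (treeVec K s) (treeVec K t) ∈ treeComponent K γ n := by
  induction n using Nat.strong_induction_on with
  | _ n ih =>
  intro s t hn a
  constructor
  · obtain ⟨l, r⟩ := s
    cases r with
    | leaf =>
      rw [treePrec_leaf]
      convert hangRight_mem l a (treeVec_mem t) using 2
      simp only [← hn, EdgeTree.size, Child.size]
      omega
    | edge e r₁ r₂ =>
      have hx : treeVec K (⟨l, .edge e r₁ r₂⟩ : EdgeTree γ) = hangRight K l e (treeVec K ⟨r₁, r₂⟩) :=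
        (hangRight_single l e ⟨r₁, r₂⟩).symm
      have ih' := ih _ (by simp only [← hn, EdgeTree.size, Child.size]; omega) ⟨r₁, r₂⟩ t rfl
      rw [hx, treePrec_hangRight]
      convert hangRight_mem l (min a e) (add_mem (ih' a).1 (ih' e).2) using 2
      simp only [← hn, EdgeTree.size, Child.size]
      omega
  · obtain ⟨l, r⟩ := t
    cases l with
    | leaf =>
      rw [treeSucc_leaf]
      convert hangLeft_mem r a (treeVec_mem s) using 2
      simp only [← hn, EdgeTree.size, Child.size]
      omega
    | edge e l₁ l₂ =>
      have hx : treeVec K (⟨.edge e l₁ l₂, r⟩ : EdgeTree γ) = hangLeft K r e (treeVec K ⟨l₁, l₂⟩) :=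
        (hangLeft_single r e ⟨l₁, l₂⟩).symm
      have ih' := ih _ (by simp only [← hn, EdgeTree.size, Child.size]; omega) s ⟨l₁, l₂⟩ rfl
      rw [hx, treeSucc_hangLeft]
      convert hangLeft_mem r (min a e) (add_mem (ih' a).2 (ih' e).1) using 2
      simp only [← hn, EdgeTree.size, Child.size]
      omega

theorem bilin_mem (f : TreeSpace K γ →ₗ[K] TreeSpace K γ →ₗ[K] TreeSpace K γ)
    (hf : ∀ s t, f (treeVec K s) (treeVec K t) ∈ treeComponent K γ (s.size + t.size)) {m n : ℕ}
    {u v : TreeSpace K γ} (hu : u ∈ treeComponent K γ m) (hv : v ∈ treeComponent K γ n) :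
    f u v ∈ treeComponent K γ (m + n) := by
  refine map_mem_of_treeVec_mem (f.flip v) (fun s hs => ?_) hu
  refine map_mem_of_treeVec_mem (f (treeVec K s)) (fun t ht => ?_) hv
  rw [← hs, ← ht]
  exact hf s t

/-- Triangularity again, applied in the quotient by `N`. -/
theorem mem_of_sum_Iic_mem {F : Fin γ → A} {N : Submodule K A}
    (h : ∀ c, ∑ a ∈ Finset.Iic c, F a ∈ N) (a : Fin γ) : F a ∈ N := by
  refine (Submodule.Quotient.mk_eq_zero N).1
    (eq_zero_of_sum_Iic (F := fun a => N.mkQ (F a)) (fun c => ?_) a)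
  rw [← map_sum]
  exact (Submodule.Quotient.mk_eq_zero N).2 (h c)

theorem op_mem {S : Algebra K γ (TreeSpace K γ)} (hP : S.prec = treePrec K)
    (hS : S.succ = treeSucc K) (g : Gen γ) {m n : ℕ} {u v : TreeSpace K γ}
    (hu : u ∈ treeComponent K γ m) (hv : v ∈ treeComponent K γ n) :
    S.op g u v ∈ treeComponent K γ (m + n) := by
  cases g with
  | left a =>
    refine mem_of_sum_Iic_mem (F := fun a => S.op (.left a) u v) (fun c => ?_) a
    have h := bilin_mem (treePrec K c) (fun s t => (tree_products_mem _ s t rfl c).1) hu hv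
    rw [← hP] at h
    simpa only [Algebra.prec, LinearMap.sum_apply] using h
  | right a =>
    refine mem_of_sum_Iic_mem (F := fun a => S.op (.right a) u v) (fun c => ?_) a
    have h := bilin_mem (treeSucc K c) (fun s t => (tree_products_mem _ s t rfl c).2) hu hv
    rw [← hS] at h
    simpa only [Algebra.succ, LinearMap.sum_apply] using h

theorem act_freeOp (op : G → A →ₗ[K] A →ₗ[K] A) (b : A) (g : G) (x y : FreeOperad K G) :
    act op (fun _ => b) (freeOp K g x y) = op g (act op (fun _ => b) x) (act op (fun _ => b) y) := by
  suffices (freeOp K g).compr₂ (act op fun _ => b) =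
      (op g).compl₁₂ (act op fun _ => b) (act op fun _ => b) from LinearMap.congr_fun₂ this x y
  refine Finsupp.lhom_ext' fun l => LinearMap.ext_ring ?_
  refine Finsupp.lhom_ext' fun r => LinearMap.ext_ring ?_
  simp [freeOp_single, act_single, evalAt]

theorem freeOp_mem (g : G) {m n : ℕ} {x y : FreeOperad K G} (hx : x ∈ freeComponent K G m)
    (hy : y ∈ freeComponent K G n) : freeOp K g x y ∈ freeComponent K G (m + n) := by
  rw [freeComponent, Finsupp.supported_eq_span_single] at hx hy
  induction hx using Submodule.span_induction with
  | zero => simp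
  | add u v _ _ hu hv => rw [map_add, LinearMap.add_apply]; exact add_mem hu hv
  | smul c u _ hu => rw [map_smul, LinearMap.smul_apply]; exact Submodule.smul_mem _ c hu
  | mem x hx =>
  obtain ⟨l, rfl, rfl⟩ := hx
  induction hy using Submodule.span_induction with
  | zero => simp
  | add u v _ _ hu hv => rw [map_add]; exact add_mem hu hv
  | smul c u _ hu => rw [map_smul]; exact Submodule.smul_mem _ c hu
  | mem y hy =>
  obtain ⟨r, rfl, rfl⟩ := hy
  rw [freeOp_single]
  exact single_mem_freeComponent rfl 1

theorem map_act_freeComponent {S : Algebra K γ (TreeSpace K γ)} (hP : S.prec = treePrec K)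
    (hS : S.succ = treeSucc K) (n : ℕ) :
    (freeComponent K (Gen γ) n).map (act S.op fun _ => treeVec K (EdgeTree.one γ)) =
      treeComponent K γ n := by
  have hone : treeVec K (EdgeTree.one γ) ∈ treeComponent K γ 1 := treeVec_mem _
  apply le_antisymm
  · rw [freeComponent, Finsupp.supported_eq_span_single, Submodule.map_span, Submodule.span_le]
    rintro _ ⟨_, ⟨t, rfl, rfl⟩, rfl⟩
    simp only [SetLike.mem_coe, act_single]
    induction t with
    | leaf => exact hone
    | node g l r hl hr => exact op_mem hP hS g hl hr
  -- The images `N n` contain `•` in degree 1 and are multiplied in a graded way by all the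
  -- operations, hence by `≺` and `≻`; building a tree by hanging then places it in the right
  -- degree.
  · let N : ℕ → Submodule K (TreeSpace K γ) := fun n =>
      (freeComponent K (Gen γ) n).map (act S.op fun _ => treeVec K (EdgeTree.one γ))
    have hN1 : treeVec K (EdgeTree.one γ) ∈ N 1 :=
      ⟨single .leaf 1, single_mem_freeComponent rfl 1, by rw [act_single]; rfl⟩
    have hop : ∀ g m n u v, u ∈ N m → v ∈ N n → S.op g u v ∈ N (m + n) := by
      rintro g m n _ _ ⟨x, hx, rfl⟩ ⟨y, hy, rfl⟩
      exact ⟨freeOp K g x y, freeOp_mem g hx hy, act_freeOp _ _ _ _ _⟩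
    have hprec : ∀ a m n u v, u ∈ N m → v ∈ N n → treePrec K a u v ∈ N (m + n) := by
      intro a m n u v hu hv
      rw [← hP, Algebra.prec, LinearMap.sum_apply, LinearMap.sum_apply]
      exact sum_mem fun b _ => hop _ _ _ _ _ hu hv
    have hsucc : ∀ a m n u v, u ∈ N m → v ∈ N n → treeSucc K a u v ∈ N (m + n) := by
      intro a m n u v hu hv
      rw [← hS, Algebra.succ, LinearMap.sum_apply, LinearMap.sum_apply]
      exact sum_mem fun b _ => hop _ _ _ _ _ hu hv
    intro u hu
    refine map_mem_of_treeVec_mem LinearMap.id (fun t ht => ?_) hu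
    change treeVec K t ∈ N n
    rw [← ht]
    clear ht
    induction t using EdgeTree.hang_induction with
    | one => exact hN1
    | hang_left x t h =>
      rw [← hangLeft_single, ← treeSucc_leaf]
      exact hsucc x _ _ _ _ h hN1
    | hang_right l y t hl h =>
      rw [← hangRight_single, ← treePrec_leaf]
      convert hprec y _ _ _ _ hl h using 2
      simp only [EdgeTree.size, EdgeTree.below, Child.size]
      omega

end

end Polydendriform

-- The freeness theorem.

theorem mainTheorem6 (K : Type*) [Field K] [CharZero K] (γ : ℕ) :
    ∃ S : Polydendriform.Algebra K γ (Polydendriform.TreeSpace K γ),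
      (∀ a : Fin γ, S.prec a = Polydendriform.treePrec K a) ∧
      (∀ a : Fin γ, S.succ a = Polydendriform.treeSucc K a) ∧
      (∀ (B : Type*) [AddCommGroup B] [Module K B] (T : Polydendriform.Algebra K γ B) (b : B),
        ∃! φ : Polydendriform.TreeSpace K γ →ₗ[K] B,
          S.IsHom T φ ∧ φ (Finsupp.single (Polydendriform.EdgeTree.one γ) 1) = b) ∧
      LinearMap.ker (Polydendriform.act S.op
          (fun _ => Finsupp.single (Polydendriform.EdgeTree.one γ) 1)) =
        Polydendriform.operadIdeal (Polydendriform.dendrRel K γ) ∧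
      (∀ n : ℕ, (Polydendriform.freeComponent K (Polydendriform.Gen γ) n).map
          (Polydendriform.act S.op
            (fun _ => Finsupp.single (Polydendriform.EdgeTree.one γ) 1)) =
        Finsupp.supported K K {t : Polydendriform.EdgeTree γ | t.size = n}) := by
  obtain ⟨S, hP, hS⟩ := (Polydendriform.tree_precSuccRel K γ).exists_algebra
  exact ⟨S, congr_fun hP, congr_fun hS,
    fun B _ _ T b => Polydendriform.existsUnique_isHom hP hS T b,
    Polydendriform.ker_act_eq hP hS, Polydendriform.map_act_freeComponent hP hS⟩
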